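/- For $m\ge 0$ let $V(m)=\{e_i-e_j : 1\le i<j\le m+1\}\subset\mathbb{R}^{m+1}$ be the set of zone vectors of the permutahedron $\Pi_m$. For a finite set of vectors $V$ let $Z(V)=\sum_{v\in V}[0,v]$ be the zonotope with set of zone vectors $V$; it is a $\Pi$-zonotope if $V\subset V(m)$ for some $m$. The belt generated by a face $G$ of codimension $2$ of $Z(V)$ is the set of all facets of $Z(V)$ parallel to $G$. The Venkov graph of $Z(V)$ has as vertices the pairs of opposite facets, two distinct pairs being adjacent if and only if some belt contains both of them. The belt distance is the distance in this graph, and the belt diameter of $Z(V)$ is its diameter. A $d$-dimensional symmetric $\Pi$-zonotope is a zonotope $Z(V_R\cup V_B)$ with $V_R,V_B\subset V(m)$ for some $m$, such that $V_R\cup V_B$ spans a $d$-dimensional space and $V_R$, $V_B$ are conjugate: each of them consists of $d-1$ linearly independent vectors, $V_B\cup\{e\}$ has rank $d$ for every $e\in V_R$, and $V_R\cup\{e\}$ has rank $d$ for every $e\in V_B$. Its red (respectively blue) facets are its facets that are translates of $Z(V_R)$ (respectively $Z(V_B)$). Let $\xi_\Pi(d)$ be the maximal belt diameter of $d$-dimensional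 symmetric $\Pi$-zonotopes. Theorem. Let $d\ge 3$. In every $d$-dimensional symmetric $\Pi$-zonotope the red facets form exactly one pair of opposite facets, so do the blue facets, and the belt distance between the red and the blue pair is at most $2$ if $3\le d\le 6$ or $d=8$, and at most $3$ if $d=7$ or $d\ge 9$. These bounds are sharp: for every $d\ge 3$ there is a $d$-dimensional symmetric $\Pi$-zonotope with $V_R,V_B\subset V(d)\subset\mathbb{R}^{d+1}$ for which the belt distance between the red and the blue pair equals the bound. Moreover $$\xi_\Pi(d)=\begin{cases}2,&\text{if } 3\le d\le 6\text{ or } d=8,\\ 3,&\text{if } d=7\text{ or } d\ge 9.\end{cases}$$ -/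

import Mathlib

open scoped Pointwise

section Polytopes

variable {E : Type*} [AddCommGroup E] [Module ℝ E]

/-- The zonotope `Z(V)`: the Minkowski sum of the segments `[0, v]`, `v ∈ V`. -/
noncomputable def zonotope (V : Finset E) : Set E :=
  ∑ v ∈ V, segment ℝ (0 : E) v

/-- The (affine) dimension of a set. -/
noncomputable def polyDim (K : Set E) : ℕ :=
  Module.finrank ℝ (vectorSpan ℝ K)

/-- The face opposite to `F` in `Z(V)`: its image under the central symmetry
`x ↦ (∑ v ∈ V, v) - x` of `Z(V)`. -/
def oppositeFace (V : Finset E) (F : Set E) : Set E :=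
  (fun x => (∑ v ∈ V, v) - x) '' F

variable [TopologicalSpace E]

/-- `F` is a non-empty face of codimension `k` of the polytope `K`: the set of maximizers over `K`
of some linear functional, with `dim F + k = dim K`. -/
def IsFaceOfCodim (k : ℕ) (K F : Set E) : Prop :=
  F.Nonempty ∧ IsExposed ℝ K F ∧ polyDim F + k = polyDim K

/-- Facets are the faces of codimension one. -/
def IsFacet (K F : Set E) : Prop := IsFaceOfCodim 1 K F

/-- The belt of `K` generated by a face `G` of codimension two:
the set of all facets of `K` that are parallel to `G`. -/
def belt (K G : Set E) : Set (Set E) :=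
  {F | IsFacet K F ∧ vectorSpan ℝ G ≤ vectorSpan ℝ F}

/-- The pairs `{F, F'}` of opposite facets of `Z(V)`. -/
def FacetPair (V : Finset E) : Type _ :=
  {P : Set (Set E) // ∃ F, IsFacet (zonotope V) F ∧ P = {F, oppositeFace V F}}

/-- The Venkov graph of `Z(V)`: its vertices are the pairs of opposite facets, and two different
pairs are adjacent if and only if some belt contains both pairs. -/
def venkovGraph (V : Finset E) : SimpleGraph (FacetPair V) where
  Adj P Q := P ≠ Q ∧ ∃ G, IsFaceOfCodim 2 (zonotope V) G ∧
    P.1 ⊆ belt (zonotope V) G ∧ Q.1 ⊆ belt (zonotope V) G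
  symm := ⟨fun _ _ ⟨h, G, hG, hP, hQ⟩ => ⟨h.symm, G, hG, hQ, hP⟩⟩
  loopless := ⟨fun _ h => h.1 rfl⟩

/-- The belt distance between two pairs of opposite facets: the least length of a belt path. -/
noncomputable def beltDist (V : Finset E) (P Q : FacetPair V) : ℕ∞ :=
  (venkovGraph V).edist P Q

/-- The belt diameter of `Z(V)`: the diameter of its Venkov graph. -/
noncomputable def beltDiam (V : Finset E) : ℕ∞ :=
  (venkovGraph V).ediam

/-- `P` is the pair of opposite facets of `Z(V)` with set of zone vectors `U`,
that is, both facets in `P` are translates of `Z(U)`. -/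
def IsPairWithZones (V U : Finset E) (P : FacetPair V) : Prop :=
  ∀ F ∈ P.1, ∃ t : E, F = (fun x => t + x) '' zonotope U

end Polytopes

/-- The zone vectors `e_i - e_j`, `i < j`, of the permutahedron `Π_m` in `ℝ^(m+1)`. -/
def permVectors (m : ℕ) : Set (Fin (m + 1) → ℝ) :=
  {v | ∃ i j : Fin (m + 1), i < j ∧ v = Pi.single i 1 - Pi.single j 1}

/-- `V₁` and `V₂` are conjugate sets of vectors in a space of dimension `d` (the span of
`V₁ ∪ V₂`): each consists of `d - 1` vectors and has dimension `d - 1`, and adding to one of the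
sets any vector of the other one gives dimension `d`. -/
def Conjugate {E : Type*} [AddCommGroup E] [Module ℝ E] (d : ℕ) (V₁ V₂ : Finset E) : Prop :=
  V₁.card + 1 = d ∧ V₂.card + 1 = d ∧
  Set.finrank ℝ (V₁ : Set E) + 1 = d ∧ Set.finrank ℝ (V₂ : Set E) + 1 = d ∧
  Set.finrank ℝ ((V₁ : Set E) ∪ (V₂ : Set E)) = d ∧
  (∀ e ∈ V₁, Set.finrank ℝ (insert e (V₂ : Set E)) = d) ∧
  (∀ e ∈ V₂, Set.finrank ℝ (insert e (V₁ : Set E)) = d)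

/-- `Z(V_R ∪ V_B)` is a `d`-dimensional symmetric `Π`-zonotope, with sets of red and blue zone
vectors `V_R` and `V_B`, among the zone vectors of `Π_m`. -/
def IsSymmetricPi (d m : ℕ) (VR VB : Finset (Fin (m + 1) → ℝ)) : Prop :=
  (VR : Set (Fin (m + 1) → ℝ)) ⊆ permVectors m ∧
  (VB : Set (Fin (m + 1) → ℝ)) ⊆ permVectors m ∧
  Conjugate d VR VB

/-- `ξ_Π(d)`: the maximal belt diameter of `d`-dimensional symmetric `Π`-zonotopes. -/
noncomputable def xiPi (d : ℕ) : ℕ∞ :=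
  sSup {k | ∃ (m : ℕ) (VR VB : Finset (Fin (m + 1) → ℝ)),
    IsSymmetricPi d m VR VB ∧ k = beltDiam (VR ∪ VB)}

/-! A face of `Z(V)` is a translate of the zonotope of the zone vectors killed by its normal
(`maxFace_eq`). Facet pairs are therefore subsets of `V` of corank one cut out by a functional, and
two distinct pairs share a belt iff their common zone vectors have corank two (`adj_facetPair_iff`).
For vectors `e_i - e_j`, read as edges of a graph, the normal can be taken to be the indicator of a
vertex set (`exists_indicator`), so everything becomes a question about cuts.

Upper bounds. Let `α`, `β` be two such indicators, not in a common belt. Contract the common zone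
vectors `U` and complete `U` to bases of the two facets by sets `R` and `B` of `k` edges each. On
the contracted vertices (classes) `R` and `B` are forests. An edge of `R` changes `β` but not `α`,
an edge of `B` does the opposite, so the graph is bipartite and has degree sum `2k` on each side; at
least `k + 2` classes are touched. If a class has one edge of each colour, its star is a facet
normal in a belt with both facets, giving distance two. Otherwise every touched class meets both
colours and has degree at least three, so `k + 2 ≤ 2⌊2k/3⌋`. This excludes `k ≤ 5` and `k = 7`, and
for `k = 6` it forces all degrees to be three (`size_bound`). As the rank of `V` is `rank U + k +
1`, ranks at most six are settled. In rank eight there remains `k = 6` with `U` a single edge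
direction; the bipartition of a symmetric zonotope and divisibility by three then give an end of
that edge with no other edge of `R` or `B`, which serves as common neighbour
(`exists_path_two_of_cubic`). In every rank a red leaf and a blue leaf on the same side of `β` give
a path of length three (`Config.exists_path_three`).

Lower bounds. Red and blue share no zone vector, so their distance is at least two. A common
neighbour would be a cut with one red and at most one blue edge, which forces a vertex with at most
one edge of each colour (`exists_coord_of_cut`). Explicit pairs of forests without such a vertex
exist for `d = 7` and `d ≥ 9`. -/

set_option linter.unusedSectionVars false
set_option linter.unnecessarySeqFocus false

/-! ### Faces, facet pairs and belts of a zonotope in terms of null sets of functionals -/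

section Zonotopes

variable {E : Type*} [AddCommGroup E] [Module ℝ E]

theorem mem_zonotope {V : Finset E} {x : E} :
    x ∈ zonotope V ↔ ∃ t : E → ℝ, (∀ v ∈ V, 0 ≤ t v ∧ t v ≤ 1) ∧ x = ∑ v ∈ V, t v • v := by
  unfold zonotope
  rw [Set.mem_finsetSum]
  constructor
  · rintro ⟨g, hg, rfl⟩
    have h : ∀ v : E, ∃ s : ℝ, v ∈ V → (0 ≤ s ∧ s ≤ 1) ∧ g v = s • v := by
      intro v
      by_cases hv : v ∈ V
      · have := hg hv
        rw [segment_eq_image'] at this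
        obtain ⟨s, hs, h⟩ := this
        exact ⟨s, fun _ => ⟨hs, by simpa using h.symm⟩⟩
      · exact ⟨0, fun h => absurd h hv⟩
    choose t ht using h
    exact ⟨t, fun v hv => (ht v hv).1, Finset.sum_congr rfl fun v hv => (ht v hv).2⟩
  · rintro ⟨t, ht, rfl⟩
    refine ⟨fun v => t v • v, fun {v} hv => ?_, rfl⟩
    rw [segment_eq_image']
    exact ⟨t v, ht v hv, by simp⟩

theorem zero_mem_zonotope (V : Finset E) : (0 : E) ∈ zonotope V :=
  mem_zonotope.2 ⟨0, by simp, by simp⟩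

theorem mem_zonotope_of_mem {V : Finset E} {v : E} (hv : v ∈ V) : v ∈ zonotope V := by
  classical
  refine mem_zonotope.2 ⟨fun w => if w = v then 1 else 0, fun w _ => ?_, ?_⟩
  · dsimp only; split_ifs <;> norm_num
  · simp [ite_smul, hv]

theorem sub_mem_zonotope {V : Finset E} {x : E} (hx : x ∈ zonotope V) :
    ∑ v ∈ V, v - x ∈ zonotope V := by
  obtain ⟨t, ht, rfl⟩ := mem_zonotope.1 hx
  refine mem_zonotope.2 ⟨fun v => 1 - t v, fun v hv => ?_, ?_⟩
  · have := ht v hv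
    constructor <;> dsimp only <;> linarith
  · simp [sub_smul]

theorem vectorSpan_zonotope (V : Finset E) :
    vectorSpan ℝ (zonotope V) = Submodule.span ℝ (V : Set E) := by
  rw [vectorSpan_eq_span_vsub_set_right ℝ (zero_mem_zonotope V)]
  simp only [vsub_eq_sub, sub_zero, Set.image_id']
  apply le_antisymm
  · rw [Submodule.span_le]
    intro x hx
    obtain ⟨t, -, rfl⟩ := mem_zonotope.1 hx
    exact Submodule.sum_mem _ fun v hv =>
      Submodule.smul_mem _ _ (Submodule.subset_span (Finset.mem_coe.2 hv))
  · exact Submodule.span_mono fun v hv => mem_zonotope_of_mem hv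

theorem vectorSpan_translate (t : E) (S : Set E) :
    vectorSpan ℝ ((fun x => t + x) '' S) = vectorSpan ℝ S :=
  vectorSpan_vadd (k := ℝ) S t

theorem vectorSpan_translate_zonotope (t : E) (V : Finset E) :
    vectorSpan ℝ ((fun x => t + x) '' zonotope V) = Submodule.span ℝ (V : Set E) := by
  rw [vectorSpan_translate, vectorSpan_zonotope]

theorem polyDim_zonotope (V : Finset E) : polyDim (zonotope V) = Set.finrank ℝ (V : Set E) := by
  rw [polyDim, vectorSpan_zonotope, Set.finrank]

/-- Two functionals vanishing on a hyperplane are proportional. -/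
theorem exists_eq_mul_of_finrank [FiniteDimensional ℝ E] {V S : Set E} (hS : S ⊆ V)
    (hr : Set.finrank ℝ V ≤ Set.finrank ℝ S + 1) {f g : Module.Dual ℝ E}
    (hf : ∀ v ∈ S, f v = 0) (hg : ∀ v ∈ S, g v = 0) {w : E} (hw : w ∈ V) (hgw : g w ≠ 0) :
    ∀ v ∈ V, f v = f w / g w * g v := by
  have hwS : w ∉ Submodule.span ℝ S := fun h => by
    have : Submodule.span ℝ S ≤ LinearMap.ker g := Submodule.span_le.2 fun w hw => hg w hw
    exact hgw (this h)
  have hle : Submodule.span ℝ S ⊔ Submodule.span ℝ {w} ≤ Submodule.span ℝ V :=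
    sup_le (Submodule.span_mono hS) (Submodule.span_le.2 (by simpa using Submodule.subset_span hw))
  have hlt : Submodule.span ℝ S < Submodule.span ℝ S ⊔ Submodule.span ℝ {w} := by
    refine lt_of_le_of_ne le_sup_left fun h => hwS ?_
    rw [h]
    exact Submodule.mem_sup_right (Submodule.mem_span_singleton_self w)
  have h1 := Submodule.finrank_lt_finrank_of_lt hlt
  have heq : Submodule.span ℝ S ⊔ Submodule.span ℝ {w} = Submodule.span ℝ V := by
    apply Submodule.eq_of_le_of_finrank_le hle
    unfold Set.finrank at hr
    omega
  intro v hv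
  have hv' : v ∈ Submodule.span ℝ S ⊔ Submodule.span ℝ {w} := heq ▸ Submodule.subset_span hv
  have hker : Submodule.span ℝ S ⊔ Submodule.span ℝ {w} ≤
      LinearMap.ker (f - (f w / g w) • g) := by
    refine sup_le (Submodule.span_le.2 fun u hu => ?_) (Submodule.span_le.2 fun u hu => ?_)
    · simp [hf u hu, hg u hu]
    · rw [Set.mem_singleton_iff.1 hu]
      simp [hgw]
  have := hker hv'
  simpa [sub_eq_zero] using this

variable [TopologicalSpace E]

/-- The zone vectors in `V` annihilated by the functional `l`. -/
noncomputable def nullSet (V : Finset E) (l : StrongDual ℝ E) : Finset E :=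
  {v ∈ V | l v = 0}

@[simp] theorem mem_nullSet {V : Finset E} {l : StrongDual ℝ E} {v : E} :
    v ∈ nullSet V l ↔ v ∈ V ∧ l v = 0 := Finset.mem_filter

/-- The face of `Z(V)` on which the functional `l` attains its maximum. -/
def maxFace (V : Finset E) (l : StrongDual ℝ E) : Set E :=
  {x ∈ zonotope V | ∀ y ∈ zonotope V, l y ≤ l x}

/-- The value `∑ t v * l v` is maximised termwise: the coefficient must be 1 where `l` is positive,
0 where it is negative, and is free where `l` vanishes. -/
theorem maxFace_eq (V : Finset E) (l : StrongDual ℝ E) :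
    maxFace V l = (fun x => (∑ v ∈ V with 0 < l v, v) + x) '' zonotope (nullSet V l) := by
  have key : ∀ t : E → ℝ, (∀ v ∈ V, 0 ≤ t v ∧ t v ≤ 1) → ∀ v ∈ V,
      t v * l v ≤ if 0 < l v then l v else 0 := by
    intro t ht v hv
    have := ht v hv
    split_ifs with h
    · nlinarith
    · nlinarith
  have hl : ∀ t : E → ℝ, l (∑ v ∈ V, t v • v) = ∑ v ∈ V, t v * l v := by
    intro t; simp [map_sum]
  ext x
  constructor
  · rintro ⟨hx, hmax⟩
    obtain ⟨t, ht, rfl⟩ := mem_zonotope.1 hx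
    -- At this point of the zonotope every termwise bound in `key` is attained, so a maximizer must
    -- attain each of them.
    have h1 := hmax (∑ v ∈ V, (if 0 < l v then (1 : ℝ) else 0) • v)
      (mem_zonotope.2 ⟨_, fun v _ => by split_ifs <;> norm_num, rfl⟩)
    rw [hl, hl] at h1
    have h2 : ∑ v ∈ V, t v * l v = ∑ v ∈ V, if 0 < l v then l v else 0 := by
      apply le_antisymm (Finset.sum_le_sum (key t ht))
      simpa [ite_mul] using h1
    have h3 := (Finset.sum_eq_sum_iff_of_le (key t ht)).1 h2
    refine ⟨∑ v ∈ nullSet V l, t v • v,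
      mem_zonotope.2 ⟨t, fun v hv => ht v (mem_nullSet.1 hv).1, rfl⟩, ?_⟩
    dsimp only
    rw [nullSet, Finset.sum_filter, Finset.sum_filter, ← Finset.sum_add_distrib]
    refine Finset.sum_congr rfl fun v hv => ?_
    have h4 := h3 v hv
    rcases lt_trichotomy (l v) 0 with h | h | h
    · rw [if_neg (not_lt.2 h.le)] at h4
      have : t v = 0 := (mul_eq_zero.1 h4).resolve_right h.ne
      simp [not_lt.2 h.le, h.ne, this]
    · simp [h]
    · rw [if_pos h] at h4
      have : t v = 1 := by
        have := mul_right_cancel₀ h.ne' (h4.trans (one_mul _).symm)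
        exact this
      simp [h, h.ne', this]
  · rintro ⟨y, hy, rfl⟩
    obtain ⟨t, ht, rfl⟩ := mem_zonotope.1 hy
    have h0 : (∑ v ∈ V with 0 < l v, v) + ∑ v ∈ nullSet V l, t v • v =
        ∑ v ∈ V, (if 0 < l v then 1 else if l v = 0 then t v else 0 : ℝ) • v := by
      rw [nullSet, Finset.sum_filter, Finset.sum_filter, ← Finset.sum_add_distrib]
      refine Finset.sum_congr rfl fun v hv => ?_
      rcases lt_trichotomy (l v) 0 with h | h | h
      · simp [not_lt.2 h.le, h.ne]
      · simp [h]
      · simp [h, h.ne']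
    dsimp only
    rw [h0]
    refine ⟨mem_zonotope.2 ⟨_, fun v hv => ?_, rfl⟩, fun z hz => ?_⟩
    · split_ifs with h1 h2
      · norm_num
      · exact ht v (mem_nullSet.2 ⟨hv, h2⟩)
      · norm_num
    · obtain ⟨s, hs, rfl⟩ := mem_zonotope.1 hz
      rw [hl, hl]
      refine Finset.sum_le_sum fun v hv => (key s hs v hv).trans_eq ?_
      split_ifs with h1 h2
      · simp
      · simp [h2]
      · simp

theorem maxFace_nonempty (V : Finset E) (l : StrongDual ℝ E) : (maxFace V l).Nonempty := by
  rw [maxFace_eq]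
  exact ⟨_, _, zero_mem_zonotope _, rfl⟩

theorem vectorSpan_maxFace (V : Finset E) (l : StrongDual ℝ E) :
    vectorSpan ℝ (maxFace V l) = Submodule.span ℝ (nullSet V l : Set E) := by
  rw [maxFace_eq, vectorSpan_translate_zonotope]

theorem isFaceOfCodim_maxFace_iff {V : Finset E} {l : StrongDual ℝ E} {k : ℕ} :
    IsFaceOfCodim k (zonotope V) (maxFace V l) ↔
      Set.finrank ℝ (nullSet V l : Set E) + k = Set.finrank ℝ (V : Set E) := by
  rw [IsFaceOfCodim, polyDim_zonotope, polyDim, vectorSpan_maxFace, Set.finrank]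
  exact ⟨fun h => h.2.2, fun h => ⟨maxFace_nonempty V l, fun _ => ⟨l, rfl⟩, h⟩⟩

theorem IsFaceOfCodim.exists_eq_maxFace {V : Finset E} {F : Set E} {k : ℕ}
    (h : IsFaceOfCodim k (zonotope V) F) :
    ∃ l : StrongDual ℝ E, F = maxFace V l ∧
      Set.finrank ℝ (nullSet V l : Set E) + k = Set.finrank ℝ (V : Set E) := by
  obtain ⟨l, hl⟩ := h.2.1 h.1
  have hF : F = maxFace V l := hl
  subst hF
  exact ⟨l, rfl, isFaceOfCodim_maxFace_iff.1 h⟩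

theorem nullSet_neg (V : Finset E) (l : StrongDual ℝ E) : nullSet V (-l) = nullSet V l := by
  ext v; simp

theorem oppositeFace_maxFace (V : Finset E) (l : StrongDual ℝ E) :
    oppositeFace V (maxFace V l) = maxFace V (-l) := by
  have hsub : ∀ l : StrongDual ℝ E, oppositeFace V (maxFace V l) ⊆ maxFace V (-l) := by
    rintro l _ ⟨x, hx, rfl⟩
    refine ⟨sub_mem_zonotope hx.1, fun y hy => ?_⟩
    have := hx.2 _ (sub_mem_zonotope hy)
    simp only [map_sub, neg_apply] at this ⊢
    linarith
  refine (hsub l).antisymm fun x hx => ?_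
  refine ⟨∑ v ∈ V, v - x, ?_, by simp⟩
  have := hsub (-l) ⟨x, hx, rfl⟩
  rwa [neg_neg] at this

theorem maxFace_congr {V : Finset E} {l l' : StrongDual ℝ E} {c : ℝ} (hc : 0 < c)
    (h : ∀ v ∈ V, l' v = c * l v) : maxFace V l' = maxFace V l := by
  rw [maxFace_eq, maxFace_eq]
  have h1 : nullSet V l' = nullSet V l := by
    ext v
    simp only [mem_nullSet]
    refine and_congr_right fun hv => ?_
    rw [h v hv]
    simp [hc.ne']
  have h2 : {v ∈ V | 0 < l' v} = {v ∈ V | 0 < l v} := by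
    refine Finset.filter_congr fun v hv => ?_
    rw [h v hv]
    simp [hc]
  rw [h1, h2]

/-- The pair of opposite facets of `Z(V)` with normals `l` and `-l`. -/
def facetPair (V : Finset E) (l : StrongDual ℝ E)
    (hl : Set.finrank ℝ (nullSet V l : Set E) + 1 = Set.finrank ℝ (V : Set E)) : FacetPair V :=
  ⟨{maxFace V l, maxFace V (-l)}, maxFace V l, isFaceOfCodim_maxFace_iff.2 hl,
    by rw [oppositeFace_maxFace]⟩

theorem FacetPair.exists_eq (V : Finset E) (P : FacetPair V) :
    ∃ l, ∃ hl : Set.finrank ℝ (nullSet V l : Set E) + 1 = Set.finrank ℝ (V : Set E),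
      P = facetPair V l hl := by
  obtain ⟨P, F, hF, rfl⟩ := P
  obtain ⟨l, rfl, hl⟩ := IsFaceOfCodim.exists_eq_maxFace hF
  exact ⟨l, hl, Subtype.ext (by simp [facetPair, oppositeFace_maxFace])⟩

theorem vectorSpan_of_mem_facetPair {V : Finset E} {l : StrongDual ℝ E} {hl} {F : Set E}
    (hF : F ∈ (facetPair V l hl).1) :
    vectorSpan ℝ F = Submodule.span ℝ (nullSet V l : Set E) := by
  rcases hF with rfl | hF
  · exact vectorSpan_maxFace V l
  · rw [Set.mem_singleton_iff.1 hF, vectorSpan_maxFace, nullSet_neg]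

theorem isFacet_of_mem_facetPair {V : Finset E} {l : StrongDual ℝ E} {hl} {F : Set E}
    (hF : F ∈ (facetPair V l hl).1) : IsFacet (zonotope V) F := by
  rcases hF with rfl | hF
  · exact isFaceOfCodim_maxFace_iff.2 hl
  · rw [Set.mem_singleton_iff.1 hF]
    exact isFaceOfCodim_maxFace_iff.2 (by rwa [nullSet_neg])

theorem mem_nullSet_of_mem_span {V : Finset E} {l : StrongDual ℝ E} {v : E} (hv : v ∈ V)
    (h : v ∈ Submodule.span ℝ (nullSet V l : Set E)) : v ∈ nullSet V l := by
  refine mem_nullSet.2 ⟨hv, ?_⟩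
  have : Submodule.span ℝ (nullSet V l : Set E) ≤ LinearMap.ker l.toLinearMap :=
    Submodule.span_le.2 fun w hw => (mem_nullSet.1 hw).2
  exact this h

theorem exists_not_mem_nullSet {V : Finset E} {l : StrongDual ℝ E}
    (hr : Set.finrank ℝ (nullSet V l : Set E) + 1 = Set.finrank ℝ (V : Set E)) :
    ∃ w ∈ V, l w ≠ 0 := by
  by_contra! h
  have : nullSet V l = V := by
    ext v; simpa using h v
  rw [this] at hr
  omega

/-- Both functionals vanish on the hyperplane spanned by the smaller null set, hence are
proportional on `V` with a nonzero factor. The sign of the factor only decides whether the two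
opposite facets are swapped. -/
theorem facetPair_eq_of_nullSet_subset [FiniteDimensional ℝ E]
    {V : Finset E} {l l' : StrongDual ℝ E} {hl hl'}
    (h : nullSet V l ⊆ nullSet V l') : facetPair V l hl = facetPair V l' hl' := by
  obtain ⟨w, hw, hlw⟩ := exists_not_mem_nullSet hl
  have hprop := exists_eq_mul_of_finrank (V := (V : Set E)) (S := nullSet V l)
    (f := l'.toLinearMap) (g := l.toLinearMap) (fun v hv => (mem_nullSet.1 hv).1) hl.ge
    (fun v hv => (mem_nullSet.1 (h hv)).2) (fun v hv => (mem_nullSet.1 hv).2) hw hlw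
  have hc : l' w / l w ≠ 0 := fun h0 => by
    obtain ⟨w', hw', hlw'⟩ := exists_not_mem_nullSet hl'
    refine hlw' ?_
    have := hprop w' hw'
    simp only [ContinuousLinearMap.coe_coe] at this
    rw [this, h0, zero_mul]
  simp only [ContinuousLinearMap.coe_coe] at hprop
  apply Subtype.ext
  change ({maxFace V l, maxFace V (-l)} : Set (Set E)) = {maxFace V l', maxFace V (-l')}
  rcases lt_or_gt_of_ne hc with hc | hc
  · rw [maxFace_congr (l := -l) (l' := l') (c := -(l' w / l w)) (by linarith)
      (fun v hv => by rw [hprop v hv]; simp),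
      maxFace_congr (l := l) (l' := -l') (c := -(l' w / l w)) (by linarith)
      (fun v hv => by rw [neg_apply, hprop v hv]; ring), Set.pair_comm]
  · rw [maxFace_congr (l := l) (l' := l') hc hprop,
      maxFace_congr (l := -l) (l' := -l') hc
      (fun v hv => by simp [hprop v hv])]

theorem nullSet_eq_of_facetPair_eq {V : Finset E} {l l' : StrongDual ℝ E} {hl hl'}
    (h : facetPair V l hl = facetPair V l' hl') : nullSet V l = nullSet V l' := by
  have hsp : Submodule.span ℝ (nullSet V l : Set E) = Submodule.span ℝ (nullSet V l' : Set E) := by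
    rw [← vectorSpan_maxFace]
    apply vectorSpan_of_mem_facetPair (hl := hl')
    rw [← h]
    exact Or.inl rfl
  ext v
  constructor
  · intro hv
    exact mem_nullSet_of_mem_span (mem_nullSet.1 hv).1 (hsp ▸ Submodule.subset_span hv)
  · intro hv
    exact mem_nullSet_of_mem_span (mem_nullSet.1 hv).1 (hsp ▸ Submodule.subset_span hv)

theorem finrank_inter_add_two_le [FiniteDimensional ℝ E] [DecidableEq E]
    {V : Finset E} {l l' : StrongDual ℝ E}
    (hl : Set.finrank ℝ (nullSet V l : Set E) + 1 = Set.finrank ℝ (V : Set E))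
    (hl' : Set.finrank ℝ (nullSet V l' : Set E) + 1 = Set.finrank ℝ (V : Set E))
    (hne : facetPair V l hl ≠ facetPair V l' hl') :
    Set.finrank ℝ ((nullSet V l ∩ nullSet V l' : Finset E) : Set E) + 2 ≤
      Set.finrank ℝ (V : Set E) := by
  have hlt : Submodule.span ℝ ((nullSet V l ∩ nullSet V l' : Finset E) : Set E) <
      Submodule.span ℝ (nullSet V l : Set E) := by
    refine lt_of_le_of_ne (Submodule.span_mono (by simp)) fun h => hne ?_
    apply facetPair_eq_of_nullSet_subset
    intro v hv
    refine mem_nullSet_of_mem_span (mem_nullSet.1 hv).1 ?_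
    have hv' : v ∈ Submodule.span ℝ ((nullSet V l ∩ nullSet V l' : Finset E) : Set E) :=
      h ▸ Submodule.subset_span hv
    exact Submodule.span_mono (by simp) hv'
  have := Submodule.finrank_lt_finrank_of_lt hlt
  unfold Set.finrank at *
  omega

/-- A combination `l + c • l'` with generic `c` works: only the finitely many ratios `-(l v / l' v)`
can create new zeros. -/
theorem exists_nullSet_eq_inter [DecidableEq E] (V : Finset E) (l l' : StrongDual ℝ E) :
    ∃ g : StrongDual ℝ E, nullSet V g = nullSet V l ∩ nullSet V l' := by
  obtain ⟨c, hc⟩ := Infinite.exists_notMem_finset (insert 0 (V.image fun v => -(l v / l' v)))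
  refine ⟨l + c • l', ?_⟩
  ext v
  simp only [mem_nullSet, Finset.mem_inter, add_apply,
    smul_apply, smul_eq_mul]
  constructor
  · rintro ⟨hv, h⟩
    by_cases h' : l' v = 0
    · refine ⟨⟨hv, ?_⟩, hv, h'⟩
      rwa [h', mul_zero, add_zero] at h
    · refine absurd (Finset.mem_insert_of_mem (Finset.mem_image.2 ⟨v, hv, ?_⟩)) hc
      field_simp
      linarith
  · rintro ⟨⟨hv, h⟩, -, h'⟩
    simp [hv, h, h']

/-- The zone vectors of a face generating a common belt lie in both null sets. Conversely, a
functional whose null set is the intersection exposes such a face; its codimension is exactly two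
because distinct pairs already satisfy the opposite inequality. -/
theorem adj_facetPair_iff [FiniteDimensional ℝ E] [DecidableEq E]
    {V : Finset E} {l l' : StrongDual ℝ E}
    (hl : Set.finrank ℝ (nullSet V l : Set E) + 1 = Set.finrank ℝ (V : Set E))
    (hl' : Set.finrank ℝ (nullSet V l' : Set E) + 1 = Set.finrank ℝ (V : Set E)) :
    (venkovGraph V).Adj (facetPair V l hl) (facetPair V l' hl') ↔
      facetPair V l hl ≠ facetPair V l' hl' ∧
      Set.finrank ℝ (V : Set E) ≤
        Set.finrank ℝ ((nullSet V l ∩ nullSet V l' : Finset E) : Set E) + 2 := by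
  refine and_congr_right fun hne => ⟨?_, fun h => ?_⟩
  · rintro ⟨G, hG, h1, h2⟩
    obtain ⟨g, rfl, hg⟩ := hG.exists_eq_maxFace
    rw [← hg]
    gcongr
    refine Submodule.finrank_mono (Submodule.span_mono ?_)
    have h1' := (h1 (Or.inl rfl : maxFace V l ∈ _)).2
    have h2' := (h2 (Or.inl rfl : maxFace V l' ∈ _)).2
    rw [vectorSpan_maxFace, vectorSpan_maxFace] at h1' h2'
    intro v hv
    rw [Finset.coe_inter]
    exact ⟨mem_nullSet_of_mem_span (mem_nullSet.1 hv).1 (h1' (Submodule.subset_span hv)),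
      mem_nullSet_of_mem_span (mem_nullSet.1 hv).1 (h2' (Submodule.subset_span hv))⟩
  · obtain ⟨g, hg⟩ := exists_nullSet_eq_inter V l l'
    refine ⟨maxFace V g, isFaceOfCodim_maxFace_iff.2 ?_, fun F hF => ⟨?_, ?_⟩, fun F hF => ⟨?_, ?_⟩⟩
    · rw [hg]
      exact le_antisymm (finrank_inter_add_two_le hl hl' hne) h
    · exact isFacet_of_mem_facetPair hF
    · rw [vectorSpan_of_mem_facetPair hF, vectorSpan_maxFace, hg]
      exact Submodule.span_mono (by simp)
    · exact isFacet_of_mem_facetPair hF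
    · rw [vectorSpan_of_mem_facetPair hF, vectorSpan_maxFace, hg]
      exact Submodule.span_mono (by simp)

theorem beltDist_le_one [FiniteDimensional ℝ E] [DecidableEq E]
    {V : Finset E} {l l' : StrongDual ℝ E}
    (hl : Set.finrank ℝ (nullSet V l : Set E) + 1 = Set.finrank ℝ (V : Set E))
    (hl' : Set.finrank ℝ (nullSet V l' : Set E) + 1 = Set.finrank ℝ (V : Set E))
    (h : Set.finrank ℝ (V : Set E) ≤
        Set.finrank ℝ ((nullSet V l ∩ nullSet V l' : Finset E) : Set E) + 2) :
    beltDist V (facetPair V l hl) (facetPair V l' hl') ≤ 1 := by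
  rw [beltDist, SimpleGraph.edist_le_one_iff_adj_or_eq, adj_facetPair_iff]
  tauto

theorem beltDist_triangle {V : Finset E} (P Q R : FacetPair V) :
    beltDist V P R ≤ beltDist V P Q + beltDist V Q R :=
  SimpleGraph.edist_triangle

theorem isPairWithZones_facetPair (V : Finset E) (l : StrongDual ℝ E) (hl) :
    IsPairWithZones V (nullSet V l) (facetPair V l hl) := by
  rintro F (rfl | hF)
  · exact ⟨_, maxFace_eq V l⟩
  · rw [Set.mem_singleton_iff.1 hF]
    have h := maxFace_eq V (-l)
    rw [nullSet_neg] at h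
    exact ⟨_, h⟩

/-- Translates have the same direction space, and a null set is recovered from its span. This gives
the uniqueness of the red and of the blue pair. -/
theorem isPairWithZones_iff [FiniteDimensional ℝ E]
    {V : Finset E} {l : StrongDual ℝ E} {hl} {P : FacetPair V} :
    IsPairWithZones V (nullSet V l) P ↔ P = facetPair V l hl := by
  constructor
  · intro h
    obtain ⟨l', hl', rfl⟩ := FacetPair.exists_eq V P
    obtain ⟨t, ht⟩ := h (maxFace V l') (Or.inl rfl)
    have hsp := congrArg (vectorSpan ℝ) ht
    rw [vectorSpan_maxFace, vectorSpan_translate_zonotope] at hsp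
    apply facetPair_eq_of_nullSet_subset
    intro v hv
    exact mem_nullSet_of_mem_span (mem_nullSet.1 hv).1 (hsp ▸ Submodule.subset_span hv)
  · rintro rfl
    exact isPairWithZones_facetPair V l hl

end Zonotopes

/-! ### Ranks of finite sets of vectors -/

section Rank

variable {E : Type*} [AddCommGroup E] [Module ℝ E] [FiniteDimensional ℝ E]

theorem finrank_mono_set {S T : Set E} (h : S ⊆ T) : Set.finrank ℝ S ≤ Set.finrank ℝ T :=
  Submodule.finrank_mono (Submodule.span_mono h)

theorem finrank_union_le_add_card (S : Set E) (F : Finset E) :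
    Set.finrank ℝ (S ∪ F) ≤ Set.finrank ℝ S + F.card := by
  unfold Set.finrank
  rw [Submodule.span_union]
  exact (Submodule.finrank_add_le_finrank_add_finrank _ _).trans
    (Nat.add_le_add_left (finrank_span_finset_le_card F) _)

theorem finrank_lt_of_not_mem_span {S T : Set E} (h : S ⊆ T) {w : E} (hw : w ∈ T)
    (hwS : w ∉ Submodule.span ℝ S) : Set.finrank ℝ S + 1 ≤ Set.finrank ℝ T := by
  refine Submodule.finrank_lt_finrank_of_lt
    (lt_of_le_of_ne (Submodule.span_mono h) fun h' => hwS ?_)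
  rw [h']
  exact Submodule.subset_span hw

theorem not_mem_span_of_apply_ne_zero {S : Set E} {f : Module.Dual ℝ E} (hf : ∀ v ∈ S, f v = 0)
    {w : E} (hw : f w ≠ 0) : w ∉ Submodule.span ℝ S := fun h => by
  have : Submodule.span ℝ S ≤ LinearMap.ker f := Submodule.span_le.2 hf
  exact hw (this h)

theorem finrank_lt_of_apply_ne_zero {S T : Set E} (h : S ⊆ T) {f : Module.Dual ℝ E}
    (hf : ∀ v ∈ S, f v = 0) {w : E} (hw : w ∈ T) (hfw : f w ≠ 0) :
    Set.finrank ℝ S + 1 ≤ Set.finrank ℝ T :=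
  finrank_lt_of_not_mem_span h hw (not_mem_span_of_apply_ne_zero hf hfw)

theorem span_eq_of_finrank_le {S T : Set E} (h : S ⊆ T)
    (hr : Set.finrank ℝ T ≤ Set.finrank ℝ S) : Submodule.span ℝ S = Submodule.span ℝ T :=
  Submodule.eq_of_le_of_finrank_le (Submodule.span_mono h) hr

/-- A set can be completed to a spanning subset of a larger set by an independent set. -/
theorem exists_finset_extension {S T : Set E} (h : S ⊆ T) :
    ∃ F : Finset E, (F : Set E) ⊆ T ∧ Set.finrank ℝ (S ∪ F) = Set.finrank ℝ T ∧
      Set.finrank ℝ S + F.card = Set.finrank ℝ T := by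
  classical
  obtain ⟨k, hk⟩ := Nat.exists_eq_add_of_le (finrank_mono_set h)
  induction k generalizing S with
  | zero => exact ⟨∅, by simp, by simpa using hk.symm, by simpa using hk.symm⟩
  | succ k ih =>
    have hex : ∃ w ∈ T, w ∉ Submodule.span ℝ S := by
      by_contra! hcon
      have : Submodule.span ℝ T ≤ Submodule.span ℝ S := Submodule.span_le.2 hcon
      have := Submodule.finrank_mono this
      unfold Set.finrank at hk
      omega
    obtain ⟨w, hw, hwS⟩ := hex
    have h1 := finrank_lt_of_not_mem_span (Set.subset_insert w S) (Set.mem_insert w S) hwS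
    have h2 := finrank_union_le_add_card S {w}
    rw [Finset.coe_singleton, Set.union_singleton, Finset.card_singleton] at h2
    obtain ⟨F, hF, h3, h4⟩ := ih (S := insert w S) (Set.insert_subset hw h) (by omega)
    have hle := finrank_union_le_add_card S (insert w F)
    have hcard := Finset.card_insert_le w F
    have heq : S ∪ ((insert w F : Finset E) : Set E) = insert w S ∪ F := by
      ext; simp; tauto
    rw [heq, h3] at hle
    refine ⟨insert w F, ?_, by rw [heq, h3], by omega⟩
    rw [Finset.coe_insert]
    exact Set.insert_subset hw hF

/-- If every functional vanishing on `S` is a combination of `f` and `g` on `V`, then `S` has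
corank at most two in `V`. -/
theorem finrank_le_add_two {S V : Set E} {f g : Module.Dual ℝ E}
    (h : ∀ φ : Module.Dual ℝ E, (∀ v ∈ S, φ v = 0) → ∃ x y : ℝ, ∀ v ∈ V, φ v = x * f v + y * g v) :
    Set.finrank ℝ V ≤ Set.finrank ℝ S + 2 := by
  -- The claim is dual: the annihilator of `S` exceeds that of `V` by at most the span of `f` and
  -- `g`.
  have hle : (Submodule.span ℝ S).dualAnnihilator ≤
      (Submodule.span ℝ V).dualAnnihilator ⊔ Submodule.span ℝ {f, g} := by
    intro φ hφ
    rw [Submodule.mem_dualAnnihilator] at hφ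
    obtain ⟨x, y, hxy⟩ := h φ fun v hv => hφ v (Submodule.subset_span hv)
    refine Submodule.mem_sup.2 ⟨φ - (x • f + y • g), ?_, x • f + y • g, ?_, by simp⟩
    · rw [Submodule.mem_dualAnnihilator]
      have : Submodule.span ℝ V ≤ LinearMap.ker (φ - (x • f + y • g)) :=
        Submodule.span_le.2 fun v hv => by simp [hxy v hv]
      exact fun w hw => this hw
    · exact Submodule.mem_span_pair.2 ⟨x, y, rfl⟩
  have h1 := Subspace.finrank_add_finrank_dualAnnihilator_eq (Submodule.span ℝ S)
  have h2 := Subspace.finrank_add_finrank_dualAnnihilator_eq (Submodule.span ℝ V)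
  have h3 := (Submodule.finrank_mono hle).trans (Submodule.finrank_add_le_finrank_add_finrank _ _)
  have h4 : Module.finrank ℝ (Submodule.span ℝ ({f, g} : Set (Module.Dual ℝ E))) ≤ 2 := by
    classical
    have := finrank_span_finset_le_card (R := ℝ) ({f, g} : Finset (Module.Dual ℝ E))
    rw [Finset.coe_pair] at this
    exact this.trans Finset.card_le_two
  unfold Set.finrank
  omega

end Rank

/-! ### Functionals on vectors `e_i - e_j`; normals as cuts -/

section Roots

variable {ι : Type*} [Fintype ι] [DecidableEq ι]

/-- The functional with coordinates `f`. -/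
noncomputable def dotL (f : ι → ℝ) : StrongDual ℝ (ι → ℝ) :=
  ∑ i, f i • ContinuousLinearMap.proj i

theorem dotL_apply (f v : ι → ℝ) : dotL f v = ∑ i, f i * v i := by
  simp [dotL]

@[simp] theorem dotL_single_sub_single (f : ι → ℝ) (i j : ι) :
    dotL f (Pi.single i 1 - Pi.single j 1) = f i - f j := by
  rw [map_sub, dotL_apply, dotL_apply]
  simp [Pi.single_apply]

theorem dotL_add (f g : ι → ℝ) : dotL (f + g) = dotL f + dotL g := by
  ext v; simp [dotL_apply, add_mul, Finset.sum_add_distrib]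

theorem dotL_smul (x : ℝ) (f : ι → ℝ) : dotL (x • f) = x • dotL f := by
  ext v; simp [dotL_apply, Finset.mul_sum, mul_assoc]

theorem exists_eq_dotL (φ : Module.Dual ℝ (ι → ℝ)) : ∃ f : ι → ℝ, ∀ v, φ v = dotL f v := by
  refine ⟨fun i => φ (Pi.single i 1), fun v => ?_⟩
  rw [dotL_apply]
  conv_lhs => rw [pi_eq_sum_univ v, map_sum]
  refine Finset.sum_congr rfl fun i _ => ?_
  rw [map_smul, smul_eq_mul, mul_comm]
  congr 2
  ext j
  simp [Pi.single_apply, eq_comm]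

/-- The vectors `e_i - e_j`, `i ≠ j`. -/
def IsRoot (v : ι → ℝ) : Prop := ∃ i j, i ≠ j ∧ v = Pi.single i 1 - Pi.single j 1

theorem IsRoot.ne_zero {v : ι → ℝ} (h : IsRoot v) : v ≠ 0 := by
  obtain ⟨i, j, hij, rfl⟩ := h
  intro h
  simpa [hij] using congrFun h i

/-- Every functional defining a facet can be replaced by the indicator of a set. -/
theorem exists_indicator {V : Finset (ι → ℝ)} (hV : ∀ v ∈ V, IsRoot v) {f : ι → ℝ}
    (hf : Set.finrank ℝ (nullSet V (dotL f) : Set (ι → ℝ)) + 1 = Set.finrank ℝ (V : Set (ι → ℝ))) :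
    ∃ a : ι → ℝ, (∀ i, a i = 0 ∨ a i = 1) ∧ nullSet V (dotL a) = nullSet V (dotL f) := by
  obtain ⟨w, hw, hfw⟩ := exists_not_mem_nullSet hf
  obtain ⟨i, j, hij, rfl⟩ := hV w hw
  rw [dotL_single_sub_single] at hfw
  have hji : f j ≠ f i := fun h => hfw (by rw [h, sub_self])
  -- The indicator of one level set of `f`: it agrees at the ends of every root killed by `f` and
  -- still separates `i` from `j`, so on `V` it is a nonzero multiple of `f`.
  set a : ι → ℝ := fun k => if f k = f i then 1 else 0 with ha
  have hker : ∀ v ∈ nullSet V (dotL f), dotL a v = 0 := by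
    intro v hv
    obtain ⟨hv, h0⟩ := mem_nullSet.1 hv
    obtain ⟨p, q, -, rfl⟩ := hV v hv
    rw [dotL_single_sub_single] at h0 ⊢
    simp [ha, sub_eq_zero.1 h0]
  have haw : dotL a (Pi.single i 1 - Pi.single j 1) = 1 := by
    rw [dotL_single_sub_single]; simp [ha, hji]
  have hprop := exists_eq_mul_of_finrank (V := (V : Set (ι → ℝ))) (S := nullSet V (dotL f))
    (f := (dotL a).toLinearMap) (g := (dotL f).toLinearMap) (fun v hv => (mem_nullSet.1 hv).1)
    hf.ge hker (fun v hv => (mem_nullSet.1 hv).2) hw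
    (by rw [ContinuousLinearMap.coe_coe, dotL_single_sub_single]; exact hfw)
  simp only [ContinuousLinearMap.coe_coe] at hprop
  rw [haw, dotL_single_sub_single] at hprop
  refine ⟨a, fun k => ?_, ?_⟩
  · simp only [ha]; split_ifs <;> simp
  · ext v
    simp only [mem_nullSet]
    refine and_congr_right fun hv => ?_
    rw [hprop v hv]
    simp [hfw]

end Roots

/-! ### Two facets after contraction of their common zone vectors -/

section Configurations

variable {ι : Type*} [Fintype ι] [DecidableEq ι] {Q : Type*} [DecidableEq Q]

/-- Two normals `α ∘ c` and `β ∘ c` of facets of `Z(V)`, together with vectors `R` and `B` that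
complete the set `U` of common zone vectors of these facets to bases of the facets, and the
classes `q : Q` of coordinates which `U` connects. -/
structure Config (V U R B : Finset (ι → ℝ)) (c : ι → Q) (α β : Q → ℝ) (k : ℕ) : Prop where
  root : ∀ v ∈ V, IsRoot v
  left_indicator : ∀ q, α q = 0 ∨ α q = 1
  right_indicator : ∀ q, β q = 0 ∨ β q = 1
  mem_common : ∀ v, v ∈ U ↔ v ∈ V ∧ dotL (α ∘ c) v = 0 ∧ dotL (β ∘ c) v = 0
  mem_span : ∀ i j, c i = c j →
    (Pi.single i 1 - Pi.single j 1 : ι → ℝ) ∈ Submodule.span ℝ (U : Set (ι → ℝ))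
  eq_class : ∀ i j, (Pi.single i 1 - Pi.single j 1 : ι → ℝ) ∈ U → c i = c j
  left_sub : R ⊆ nullSet V (dotL (α ∘ c))
  right_sub : B ⊆ nullSet V (dotL (β ∘ c))
  left_card : R.card = k
  right_card : B.card = k
  left_rank : Set.finrank ℝ ((U : Set (ι → ℝ)) ∪ R) = Set.finrank ℝ (U : Set (ι → ℝ)) + k
  right_rank : Set.finrank ℝ ((U : Set (ι → ℝ)) ∪ B) = Set.finrank ℝ (U : Set (ι → ℝ)) + k
  rank : Set.finrank ℝ (V : Set (ι → ℝ)) = Set.finrank ℝ (U : Set (ι → ℝ)) + k + 1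
  two_le : 2 ≤ k

/-- The indicator of the class `q`. -/
noncomputable def ind (c : ι → Q) (q : Q) : ι → ℝ := fun i => if c i = q then 1 else 0

/-- The class `q` contains exactly one end of `v`. -/
def Touches (c : ι → Q) (q : Q) (v : ι → ℝ) : Prop := dotL (ind c q) v ≠ 0

noncomputable instance (c : ι → Q) (q : Q) : DecidablePred (Touches c q) := Classical.decPred _

/-- The number of vectors in `F` that touch `q`. -/
noncomputable def classDeg (c : ι → Q) (F : Finset (ι → ℝ)) (q : Q) : ℕ :=
  (F.filter (Touches c q)).card

theorem touches_iff {c : ι → Q} {i j : ι} (h : c i ≠ c j) {q : Q} :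
    Touches c q (Pi.single i 1 - Pi.single j 1) ↔ c i = q ∨ c j = q := by
  rw [Touches, dotL_single_sub_single, ind, ind]
  by_cases h1 : c i = q <;> by_cases h2 : c j = q
  · exact absurd (h1.trans h2.symm) h
  · simp [h1, h2]
  · simp [h1, h2]
  · simp [h1, h2]

/-- Vectors that join classes of a nonempty set `T` have rank less than `|T|` modulo `U`. -/
theorem finrank_union_lt {U F : Finset (ι → ℝ)} {c : ι → Q} {T : Finset Q}
    (hc : ∀ i j, c i = c j →
      (Pi.single i 1 - Pi.single j 1 : ι → ℝ) ∈ Submodule.span ℝ (U : Set (ι → ℝ)))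
    (hT : ∃ i, c i ∈ T)
    (hF : ∀ v ∈ F, ∃ i j, v = Pi.single i 1 - Pi.single j 1 ∧ c i ∈ T ∧ c j ∈ T) :
    Set.finrank ℝ ((U : Set (ι → ℝ)) ∪ F) + 1 ≤ Set.finrank ℝ (U : Set (ι → ℝ)) + T.card := by
  obtain ⟨i₀, ht₀⟩ := hT
  classical
  have : Nonempty ι := ⟨i₀⟩
  set rep : Q → ι := Function.invFun c with hrep
  have hcrep : ∀ i, c (rep (c i)) = c i := fun i => Function.invFun_eq ⟨i, rfl⟩
  -- A star from `i₀` to representatives of the other classes of `T`. Its at most `|T| - 1` vectors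
  -- generate, modulo `U`, every vector joining classes of `T`.
  set D : Finset (ι → ℝ) := (T.erase (c i₀)).image
    fun t => (Pi.single (rep t) 1 - Pi.single i₀ 1 : ι → ℝ) with hD
  have key : ∀ i, c i ∈ T → (Pi.single i 1 - Pi.single i₀ 1 : ι → ℝ) ∈
      Submodule.span ℝ ((U : Set (ι → ℝ)) ∪ D) := by
    intro i hi
    by_cases h : c i = c i₀
    · exact Submodule.span_mono Set.subset_union_left (hc i i₀ h)
    · have h1 : (Pi.single i 1 - Pi.single (rep (c i)) 1 : ι → ℝ) ∈
          Submodule.span ℝ ((U : Set (ι → ℝ)) ∪ D) :=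
        Submodule.span_mono Set.subset_union_left (hc _ _ (hcrep i).symm)
      have h2 : (Pi.single (rep (c i)) 1 - Pi.single i₀ 1 : ι → ℝ) ∈
          Submodule.span ℝ ((U : Set (ι → ℝ)) ∪ D) :=
        Submodule.subset_span (Or.inr (Finset.mem_coe.2 (Finset.mem_image.2
          ⟨c i, Finset.mem_erase.2 ⟨h, hi⟩, rfl⟩)))
      simpa using Submodule.add_mem _ h1 h2
  have hle : Submodule.span ℝ ((U : Set (ι → ℝ)) ∪ F) ≤
      Submodule.span ℝ ((U : Set (ι → ℝ)) ∪ D) := by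
    rw [Submodule.span_le, Set.union_subset_iff]
    refine ⟨fun v hv => Submodule.subset_span (Or.inl hv), fun v hv => ?_⟩
    obtain ⟨i, j, rfl, hi, hj⟩ := hF v hv
    simpa using Submodule.sub_mem _ (key i hi) (key j hj)
  have h1 := Submodule.finrank_mono hle
  have h2 := finrank_union_le_add_card (U : Set (ι → ℝ)) D
  have h3 : D.card ≤ (T.erase (c i₀)).card := Finset.card_image_le
  have h4 := Finset.card_erase_add_one ht₀
  unfold Set.finrank at *
  omega

namespace Config

variable {V U R B : Finset (ι → ℝ)} {c : ι → Q} {α β : Q → ℝ} {k : ℕ}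

theorem symm (h : Config V U R B c α β k) : Config V U B R c β α k where
  root := h.root
  left_indicator := h.right_indicator
  right_indicator := h.left_indicator
  mem_common v := by rw [h.mem_common]; tauto
  mem_span := h.mem_span
  eq_class := h.eq_class
  left_sub := h.right_sub
  right_sub := h.left_sub
  left_card := h.right_card
  right_card := h.left_card
  left_rank := h.right_rank
  right_rank := h.left_rank
  rank := h.rank
  two_le := h.two_le

variable (h : Config V U R B c α β k)
include h

theorem left_mem {v : ι → ℝ} (hv : v ∈ R) : v ∈ V := (mem_nullSet.1 (h.left_sub hv)).1

theorem dotL_comp_common (φ : Q → ℝ) {v : ι → ℝ} (hv : v ∈ U) : dotL (φ ∘ c) v = 0 := by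
  obtain ⟨i, j, -, rfl⟩ := h.root v ((h.mem_common v).1 hv).1
  rw [dotL_single_sub_single, Function.comp, Function.comp, h.eq_class i j hv, sub_self]

theorem dotL_ind_common (q : Q) {v : ι → ℝ} (hv : v ∈ U) : dotL (ind c q) v = 0 :=
  h.dotL_comp_common (fun p => if p = q then 1 else 0) hv

theorem apply_eq_of_class_eq {f : ι → ℝ} (hf : ∀ v ∈ U, dotL f v = 0) {i j : ι} (hij : c i = c j) :
    f i = f j := by
  have h1 : Submodule.span ℝ (U : Set (ι → ℝ)) ≤ LinearMap.ker (dotL f).toLinearMap :=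
    Submodule.span_le.2 hf
  have h2 := h1 (h.mem_span i j hij)
  simpa [sub_eq_zero] using h2

theorem left_independent {F : Finset (ι → ℝ)} (hF : F ⊆ R) :
    Set.finrank ℝ ((U : Set (ι → ℝ)) ∪ F) = Set.finrank ℝ (U : Set (ι → ℝ)) + F.card := by
  classical
  apply le_antisymm (finrank_union_le_add_card _ _)
  have h1 := finrank_union_le_add_card ((U : Set (ι → ℝ)) ∪ F) (R \ F)
  rw [Set.union_assoc, ← Finset.coe_union, Finset.union_sdiff_of_subset hF, h.left_rank,
    Finset.card_sdiff_of_subset hF, h.left_card] at h1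
  have := Finset.card_le_card hF
  rw [h.left_card] at this
  omega

theorem right_independent {F : Finset (ι → ℝ)} (hF : F ⊆ B) :
    Set.finrank ℝ ((U : Set (ι → ℝ)) ∪ F) = Set.finrank ℝ (U : Set (ι → ℝ)) + F.card :=
  h.symm.left_independent hF

/-- A vector of `R` killed by `β` as well would belong to `U` and could not raise its rank. -/
theorem right_ne_zero {v : ι → ℝ} (hv : v ∈ R) : dotL (β ∘ c) v ≠ 0 := by
  intro h0
  have hU : v ∈ U := (h.mem_common v).2 ⟨h.left_mem hv, (mem_nullSet.1 (h.left_sub hv)).2, h0⟩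
  have h1 := h.left_independent (Finset.singleton_subset_iff.2 hv)
  rw [Finset.coe_singleton, Set.union_eq_self_of_subset_right (by simpa using hU),
    Finset.card_singleton] at h1
  omega

theorem left_ends {v : ι → ℝ} (hv : v ∈ R) : ∃ i j, v = Pi.single i 1 - Pi.single j 1 ∧
    α (c i) = α (c j) ∧ β (c i) ≠ β (c j) ∧ c i ≠ c j := by
  have hβ := h.right_ne_zero hv
  have hα := (mem_nullSet.1 (h.left_sub hv)).2
  obtain ⟨i, j, -, rfl⟩ := h.root v (h.left_mem hv)
  rw [dotL_single_sub_single, sub_eq_zero] at hα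
  rw [dotL_single_sub_single, sub_ne_zero] at hβ
  exact ⟨i, j, rfl, hα, hβ, fun h => hβ (by simp [h])⟩

theorem right_ends {v : ι → ℝ} (hv : v ∈ B) : ∃ i j, v = Pi.single i 1 - Pi.single j 1 ∧
    β (c i) = β (c j) ∧ α (c i) ≠ α (c j) ∧ c i ≠ c j := h.symm.left_ends hv

theorem left_nonempty : R.Nonempty :=
  Finset.card_pos.1 (by have := h.left_card; have := h.two_le; omega)

/-- `U` and `R` span a hyperplane on which `α` vanishes, and any vector of `B` leaves it. -/
theorem span_eq :
    Submodule.span ℝ ((U : Set (ι → ℝ)) ∪ R ∪ B) = Submodule.span ℝ (V : Set (ι → ℝ)) := by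
  apply span_eq_of_finrank_le
  · refine Set.union_subset (Set.union_subset ?_ ?_) ?_
    · exact fun v hv => ((h.mem_common v).1 hv).1
    · exact fun v hv => h.left_mem hv
    · exact fun v hv => h.symm.left_mem hv
  · obtain ⟨w, hw⟩ := h.symm.left_nonempty
    rw [h.rank, ← h.left_rank]
    refine finrank_lt_of_apply_ne_zero (f := (dotL (α ∘ c)).toLinearMap) Set.subset_union_left ?_
      (Or.inr hw) (h.symm.right_ne_zero hw)
    rintro v (hv | hv)
    · exact h.dotL_comp_common α hv
    · exact (mem_nullSet.1 (h.left_sub hv)).2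

/-- A functional vanishing on `U`, `R` and `B` vanishes on `V`. -/
theorem dotL_eq_zero {f : ι → ℝ} (hU : ∀ v ∈ U, dotL f v = 0) (hR : ∀ v ∈ R, dotL f v = 0)
    (hB : ∀ v ∈ B, dotL f v = 0) : ∀ v ∈ V, dotL f v = 0 := by
  have h1 : Submodule.span ℝ ((U : Set (ι → ℝ)) ∪ R ∪ B) ≤ LinearMap.ker (dotL f).toLinearMap := by
    refine Submodule.span_le.2 ?_
    rintro v ((hv | hv) | hv)
    · exact hU v hv
    · exact hR v hv
    · exact hB v hv
  rw [h.span_eq] at h1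
  exact fun v hv => h1 (Submodule.subset_span hv)

/-- A functional vanishing on `U` and `R` is a multiple of `α` on `V`. -/
theorem exists_eq_mul_left {f : ι → ℝ} (hU : ∀ v ∈ U, dotL f v = 0) (hR : ∀ v ∈ R, dotL f v = 0) :
    ∃ x : ℝ, ∀ v ∈ V, dotL f v = x * dotL (α ∘ c) v := by
  obtain ⟨w, hw⟩ := h.symm.left_nonempty
  refine ⟨_, exists_eq_mul_of_finrank (V := (V : Set (ι → ℝ))) (S := (U : Set (ι → ℝ)) ∪ R)
    (f := (dotL f).toLinearMap) (g := (dotL (α ∘ c)).toLinearMap) ?_ ?_ ?_ ?_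
    (h.symm.left_mem hw) (h.symm.right_ne_zero hw)⟩
  · rintro v (hv | hv)
    · exact ((h.mem_common v).1 hv).1
    · exact h.left_mem hv
  · rw [h.rank, h.left_rank]
  · rintro v (hv | hv)
    · exact hU v hv
    · exact hR v hv
  · rintro v (hv | hv)
    · exact h.dotL_comp_common α hv
    · exact (mem_nullSet.1 (h.left_sub hv)).2

/-- A class touched by no vector of `R` but by some vector of `B` is touched by all of `B`. -/
theorem touches_of_classDeg_eq_zero {q : Q} (h0 : classDeg c R q = 0) (h1 : classDeg c B q ≠ 0) :
    ∀ v ∈ B, Touches c q v := by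
  have hR : ∀ v ∈ R, dotL (ind c q) v = 0 := by
    intro v hv
    rw [classDeg, Finset.card_eq_zero, Finset.filter_eq_empty_iff] at h0
    exact not_not.1 (h0 hv)
  -- The indicator of `q` vanishes on `U` and `R`, so on `V` it is a multiple of `α`, which is
  -- nonzero on all of `B`.
  obtain ⟨x, hx⟩ := h.exists_eq_mul_left (fun v hv => h.dotL_ind_common q hv) hR
  obtain ⟨w, hw⟩ := Finset.card_pos.1 (Nat.pos_of_ne_zero h1)
  obtain ⟨hw, hqw⟩ := Finset.mem_filter.1 hw
  have hx0 : x ≠ 0 := fun h0 => hqw (by rw [hx w (h.symm.left_mem hw), h0, zero_mul])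
  intro v hv
  rw [Touches, hx v (h.symm.left_mem hv)]
  exact mul_ne_zero hx0 (h.symm.right_ne_zero hv)

theorem classDeg_eq_of_classDeg_eq_zero {q : Q} (h0 : classDeg c R q = 0)
    (h1 : classDeg c B q ≠ 0) : classDeg c B q = k := by
  rw [classDeg, Finset.filter_true_of_mem (h.touches_of_classDeg_eq_zero h0 h1), h.right_card]

/-- At most one vector of `R` joins two given classes. -/
theorem eq_of_touches {p q : Q} (hpq : p ≠ q) {v w : ι → ℝ} (hv : v ∈ R) (hw : w ∈ R)
    (hvp : Touches c p v) (hvq : Touches c q v) (hwp : Touches c p w) (hwq : Touches c q w) :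
    v = w := by
  classical
  by_contra hne
  have key : ∀ u ∈ ({v, w} : Finset (ι → ℝ)), ∃ i j, u = Pi.single i 1 - Pi.single j 1 ∧
      c i ∈ ({p, q} : Finset Q) ∧ c j ∈ ({p, q} : Finset Q) := by
    intro u hu
    have hu' : u ∈ R ∧ Touches c p u ∧ Touches c q u := by
      rcases Finset.mem_insert.1 hu with rfl | hu
      · exact ⟨hv, hvp, hvq⟩
      · rw [Finset.mem_singleton.1 hu]; exact ⟨hw, hwp, hwq⟩
    obtain ⟨huR, hup, huq⟩ := hu'
    obtain ⟨i, j, rfl, -, -, hij⟩ := h.left_ends huR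
    refine ⟨i, j, rfl, ?_⟩
    rw [touches_iff hij] at hup huq
    simp only [Finset.mem_insert, Finset.mem_singleton]
    rcases hup with rfl | rfl <;> rcases huq with rfl | rfl <;> tauto
  obtain ⟨i, -, -, hi, -⟩ := key v (by simp)
  -- Two parallel edges would have rank at most one modulo `U`, against the independence of `R`.
  have h1 := finrank_union_lt h.mem_span ⟨i, hi⟩ key
  have h2 : ({v, w} : Finset (ι → ℝ)) ⊆ R := by
    intro u hu
    rcases Finset.mem_insert.1 hu with rfl | hu
    · exact hv
    · rwa [Finset.mem_singleton.1 hu]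
  rw [h.left_independent h2, Finset.card_pair hne, Finset.card_pair hpq] at h1
  omega

/-- If all of `B` touches `p`, then any other class has at most one vector of `B`. -/
theorem classDeg_le_one_of_forall_touches {p q : Q} (hpq : p ≠ q) (hp : ∀ v ∈ B, Touches c p v) :
    classDeg c B q ≤ 1 := by
  rw [classDeg, Finset.card_le_one]
  intro v hv w hw
  obtain ⟨hv, hvq⟩ := Finset.mem_filter.1 hv
  obtain ⟨hw, hwq⟩ := Finset.mem_filter.1 hw
  exact h.symm.eq_of_touches hpq hv hw (hp v hv) hvq (hp w hw) hwq

end Config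

end Configurations

/-! ### Degree counts in the contracted graph -/

section Counting

variable {ι : Type*} [Fintype ι] [DecidableEq ι] {Q : Type*} [Fintype Q] [DecidableEq Q]

theorem sum_classDeg (c : ι → Q) (F : Finset (ι → ℝ)) (P : Finset Q) :
    ∑ q ∈ P, classDeg c F q = ∑ v ∈ F, (P.filter fun q => Touches c q v).card := by
  simp only [classDeg, Finset.card_filter]
  exact Finset.sum_comm

/-- The classes touched by `R` or by `B`. -/
noncomputable def touched (c : ι → Q) (R B : Finset (ι → ℝ)) : Finset Q :=
  Finset.univ.filter fun q => classDeg c R q + classDeg c B q ≠ 0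

theorem mem_touched {c : ι → Q} {R B : Finset (ι → ℝ)} {q : Q} :
    q ∈ touched c R B ↔ classDeg c R q + classDeg c B q ≠ 0 := by
  simp [touched]

theorem mem_touched_of_touches {c : ι → Q} {R B : Finset (ι → ℝ)} {q : Q} {v : ι → ℝ}
    (hv : v ∈ R) (hq : Touches c q v) : q ∈ touched c R B := by
  have : 0 < classDeg c R q := Finset.card_pos.2 ⟨v, Finset.mem_filter.2 ⟨hv, hq⟩⟩
  rw [mem_touched]
  omega

theorem touched_comm (c : ι → Q) (R B : Finset (ι → ℝ)) : touched c B R = touched c R B := by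
  ext q
  rw [mem_touched, mem_touched, add_comm]

namespace Config

variable {V U R B : Finset (ι → ℝ)} {c : ι → Q} {α β : Q → ℝ} {k : ℕ}
variable (h : Config V U R B c α β k)
include h

theorem card_touching {v : ι → ℝ} (hv : v ∈ R) (P : Finset Q) :
    (P.filter fun q => Touches c q v).card ≤ 2 := by
  obtain ⟨i, j, rfl, -, -, hij⟩ := h.left_ends hv
  refine (Finset.card_le_card (t := {c i, c j}) fun q hq => ?_).trans Finset.card_le_two
  have := (touches_iff hij).1 (Finset.mem_filter.1 hq).2
  simp only [Finset.mem_insert, Finset.mem_singleton]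
  tauto

/-- Along a vector of `R` the two-valued `β` changes and `α` does not, so exactly one end satisfies
`α = β`. By symmetry the same holds for `B`: the graph is bipartite. -/
theorem card_touching_same_side {v : ι → ℝ} (hv : v ∈ R) :
    ((Finset.univ.filter fun q => α q = β q).filter fun q => Touches c q v).card = 1 := by
  obtain ⟨i, j, rfl, hα, hβ, hij⟩ := h.left_ends hv
  rw [Finset.card_eq_one]
  by_cases hi : α (c i) = β (c i)
  · refine ⟨c i, Finset.ext fun q => ?_⟩
    simp only [Finset.mem_filter, Finset.mem_univ, true_and, touches_iff hij, Finset.mem_singleton]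
    constructor
    · rintro ⟨hq, rfl | rfl⟩
      · rfl
      · exact absurd (by rw [← hi, ← hq, hα]) hβ
    · rintro rfl
      exact ⟨hi, Or.inl rfl⟩
  · have hj : α (c j) = β (c j) := by
      rcases h.left_indicator (c i) with h1 | h1 <;> rcases h.right_indicator (c i) with h2 | h2 <;>
      rcases h.right_indicator (c j) with h3 | h3 <;> simp_all
    refine ⟨c j, Finset.ext fun q => ?_⟩
    simp only [Finset.mem_filter, Finset.mem_univ, true_and, touches_iff hij, Finset.mem_singleton]
    constructor
    · rintro ⟨hq, rfl | rfl⟩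
      · exact absurd hq hi
      · rfl
    · rintro rfl
      exact ⟨hj, Or.inr rfl⟩

theorem card_touching_univ {v : ι → ℝ} (hv : v ∈ R) :
    (Finset.univ.filter fun q => Touches c q v).card = 2 := by
  obtain ⟨i, j, rfl, -, -, hij⟩ := h.left_ends hv
  rw [← Finset.card_pair hij]
  congr 1
  ext q
  simp [touches_iff hij, eq_comm]

theorem sum_univ : ∑ q, classDeg c R q = 2 * k := by
  rw [sum_classDeg, Finset.sum_congr rfl fun v hv => h.card_touching_univ hv]
  simp [h.left_card, mul_comm]

theorem sum_same_side : ∑ q with α q = β q, classDeg c R q = k := by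
  rw [sum_classDeg, Finset.sum_congr rfl fun v hv => h.card_touching_same_side hv]
  simp [h.left_card]

theorem sum_other_side : ∑ q with ¬ α q = β q, classDeg c R q = k := by
  have h1 := Finset.sum_filter_add_sum_filter_not Finset.univ (fun q => α q = β q)
    (fun q => classDeg c R q)
  rw [h.sum_same_side, h.sum_univ] at h1
  omega

theorem sum_deg_same_side : ∑ q with α q = β q, (classDeg c R q + classDeg c B q) = 2 * k := by
  have h1 := h.symm.sum_same_side
  simp only [eq_comm (a := β _)] at h1
  rw [Finset.sum_add_distrib, h.sum_same_side, h1, two_mul]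

theorem sum_deg_other_side : ∑ q with ¬ α q = β q, (classDeg c R q + classDeg c B q) = 2 * k := by
  have h1 := h.symm.sum_other_side
  simp only [eq_comm (a := β _)] at h1
  rw [Finset.sum_add_distrib, h.sum_other_side, h1, two_mul]

theorem ends_mem_touched {v : ι → ℝ} (hv : v ∈ R) :
    ∃ i j, v = Pi.single i 1 - Pi.single j 1 ∧ c i ∈ touched c R B ∧ c j ∈ touched c R B := by
  obtain ⟨i, j, rfl, -, -, hij⟩ := h.left_ends hv
  exact ⟨i, j, rfl, mem_touched_of_touches hv ((touches_iff hij).2 (Or.inl rfl)),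
    mem_touched_of_touches hv ((touches_iff hij).2 (Or.inr rfl))⟩

/-- `R` and `B` together add `k + 1` to the rank of `U`, while edges among `t` classes add at most
`t - 1`. -/
theorem le_card_touched : k + 2 ≤ (touched c R B).card := by
  classical
  have hF : ∀ v ∈ R ∪ B, ∃ i j, v = Pi.single i 1 - Pi.single j 1 ∧
      c i ∈ touched c R B ∧ c j ∈ touched c R B := by
    intro v hv
    rcases Finset.mem_union.1 hv with hv | hv
    · exact h.ends_mem_touched hv
    · rw [← touched_comm]
      exact h.symm.ends_mem_touched hv
  obtain ⟨w, hw⟩ := h.left_nonempty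
  obtain ⟨i, -, -, hi, -⟩ := h.ends_mem_touched hw
  have h1 := finrank_union_lt h.mem_span ⟨i, hi⟩ hF
  have h2 : Set.finrank ℝ ((U : Set (ι → ℝ)) ∪ (R ∪ B : Finset (ι → ℝ))) =
      Set.finrank ℝ (V : Set (ι → ℝ)) := by
    rw [Finset.coe_union, ← Set.union_assoc]
    unfold Set.finrank
    rw [h.span_eq]
  have := h.rank
  omega

/-- If some touched class is not touched by `R`, then some class is touched exactly once by each
of `R` and `B`. -/
theorem exists_one_one_of_classDeg_eq_zero {p : Q} (hp : classDeg c R p = 0)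
    (hp' : classDeg c B p ≠ 0) : ∃ q, classDeg c R q = 1 ∧ classDeg c B q = 1 := by
  by_contra! hno
  have hall := h.touches_of_classDeg_eq_zero hp hp'
  have hk := h.two_le
  -- Since all of `B` meets `p`, any other class has at most one vector of `B`; without a class of
  -- type (1, 1) it then needs two of `R`. At least `k + 1` such classes exceed the total degree `2
  -- * k` of `R`.
  have hge : ∀ q ∈ (touched c R B).erase p, 2 ≤ classDeg c R q := by
    intro q hq
    obtain ⟨hqp, hq⟩ := Finset.mem_erase.1 hq
    rw [mem_touched] at hq
    have h1 := h.classDeg_le_one_of_forall_touches hqp.symm hall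
    have h2 : classDeg c R q ≠ 0 := fun h0 => by
      have := h.classDeg_eq_of_classDeg_eq_zero h0 (by omega)
      omega
    have h3 : classDeg c B q = 0 → classDeg c R q = k := fun h0 =>
      h.symm.classDeg_eq_of_classDeg_eq_zero h0 h2
    have h4 := hno q
    omega
  have h1 := Finset.card_nsmul_le_sum _ (fun q => classDeg c R q) _ hge
  have h2 : ∑ q ∈ (touched c R B).erase p, classDeg c R q ≤ ∑ q, classDeg c R q :=
    Finset.sum_le_sum_of_subset (Finset.subset_univ _)
  rw [h.sum_univ] at h2
  have h3 := h.le_card_touched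
  have h4 := Finset.card_erase_add_one (mem_touched.2 (by omega) : p ∈ touched c R B)
  rw [smul_eq_mul] at h1
  omega

section NoOneOne

variable (hno : ∀ q, ¬ (classDeg c R q = 1 ∧ classDeg c B q = 1))
include hno

theorem classDeg_left_pos {q : Q} (hq : q ∈ touched c R B) : 0 < classDeg c R q := by
  rw [mem_touched] at hq
  by_contra h0
  obtain ⟨p, hp⟩ := h.exists_one_one_of_classDeg_eq_zero (p := q) (by omega) (by omega)
  exact hno p hp

theorem classDeg_right_pos {q : Q} (hq : q ∈ touched c R B) : 0 < classDeg c B q :=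
  h.symm.classDeg_left_pos (fun q hq => hno q hq.symm) (by rwa [touched_comm])

theorem three_le_deg {q : Q} (hq : q ∈ touched c R B) : 3 ≤ classDeg c R q + classDeg c B q := by
  have h1 := h.classDeg_left_pos hno hq
  have h2 := h.classDeg_right_pos hno hq
  have h3 := hno q
  omega

theorem three_mul_card_le (p : Q → Prop) [DecidablePred p]
    (hp : ∑ q with p q, (classDeg c R q + classDeg c B q) = 2 * k) :
    3 * ((touched c R B).filter p).card ≤ 2 * k ∧
    (3 * ((touched c R B).filter p).card = 2 * k →
      ∀ q ∈ touched c R B, p q → classDeg c R q + classDeg c B q = 3) := by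
  have hle : ∀ q ∈ (touched c R B).filter p, 3 ≤ classDeg c R q + classDeg c B q :=
    fun q hq => h.three_le_deg hno (Finset.mem_filter.1 hq).1
  have h1 : ∑ q ∈ (touched c R B).filter p, 3 = 3 * ((touched c R B).filter p).card := by
    simp [mul_comm]
  have h2 : ∑ q ∈ (touched c R B).filter p, (classDeg c R q + classDeg c B q) ≤ 2 * k := by
    rw [← hp]
    exact Finset.sum_le_sum_of_subset (Finset.filter_subset_filter _ (Finset.subset_univ _))
  have h3 := Finset.sum_le_sum hle
  refine ⟨by omega, fun heq q hq hpq => ?_⟩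
  have h4 := (Finset.sum_eq_sum_iff_of_le hle).1 (by omega)
  exact (h4 q (Finset.mem_filter.2 ⟨hq, hpq⟩)).symm

/-- Each side has degree sum `2 * k` and degrees at least three, hence at most `⌊2k/3⌋` touched
classes, while `k + 2` are needed in all. For `k = 6` this reads `4 + 4 = 8`, so every degree is
exactly three. -/
theorem size_bound : 6 ≤ k ∧ k ≠ 7 ∧
    (k = 6 → ∀ q ∈ touched c R B, classDeg c R q + classDeg c B q = 3) := by
  obtain ⟨h1, h1'⟩ := h.three_mul_card_le hno _ h.sum_deg_same_side
  obtain ⟨h2, h2'⟩ := h.three_mul_card_le hno _ h.sum_deg_other_side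
  have h3 := h.le_card_touched
  rw [← Finset.card_filter_add_card_filter_not (fun q => α q = β q)] at h3
  refine ⟨by omega, by omega, fun hk q hq => ?_⟩
  by_cases hq' : α q = β q
  · exact h1' (by omega) q hq hq'
  · exact h2' (by omega) q hq hq'

end NoOneOne

end Config

end Counting

/-! ### Belt paths through stars of classes -/

section Paths

variable {ι : Type*} [Fintype ι] [DecidableEq ι] {Q : Type*} [Fintype Q] [DecidableEq Q]

/-- `f` is the normal of a facet of `Z(V)`. -/
abbrev IsNormal (V : Finset (ι → ℝ)) (f : ι → ℝ) : Prop :=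
  Set.finrank ℝ (nullSet V (dotL f) : Set (ι → ℝ)) + 1 = Set.finrank ℝ (V : Set (ι → ℝ))

/-- The facets with normals `f` and `g` are parallel or lie in a common belt. -/
def Close (V : Finset (ι → ℝ)) (f g : ι → ℝ) : Prop :=
  Set.finrank ℝ (V : Set (ι → ℝ)) ≤
    Set.finrank ℝ ((nullSet V (dotL f) ∩ nullSet V (dotL g) : Finset (ι → ℝ)) : Set (ι → ℝ)) + 2

theorem Close.symm {V : Finset (ι → ℝ)} {f g : ι → ℝ} (h : Close V f g) : Close V g f := by
  rwa [Close, Finset.inter_comm]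

theorem IsNormal.of_nullSet_eq {V : Finset (ι → ℝ)} {f g : ι → ℝ} (h : IsNormal V f)
    (hfg : nullSet V (dotL g) = nullSet V (dotL f)) : IsNormal V g := by
  rwa [IsNormal, hfg]

theorem finrank_nullSet_lt {V : Finset (ι → ℝ)} {f w : ι → ℝ} (hw : w ∈ V) (hf : dotL f w ≠ 0) :
    Set.finrank ℝ (nullSet V (dotL f) : Set (ι → ℝ)) + 1 ≤ Set.finrank ℝ (V : Set (ι → ℝ)) :=
  finrank_lt_of_apply_ne_zero (f := (dotL f).toLinearMap) (fun _ hv => (mem_nullSet.1 hv).1)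
    (fun _ hv => (mem_nullSet.1 hv).2) hw hf

namespace Config

variable {V U R B : Finset (ι → ℝ)} {c : ι → Q} {α β : Q → ℝ} {k : ℕ}
variable (h : Config V U R B c α β k)
include h

theorem le_finrank_untouched {q : Q} (hq : classDeg c R q ≤ 1) :
    Set.finrank ℝ (V : Set (ι → ℝ)) ≤ Set.finrank ℝ
      ((U : Set (ι → ℝ)) ∪ (R.filter fun v => ¬ Touches c q v : Finset (ι → ℝ))) + 2 := by
  rw [h.left_independent (Finset.filter_subset _ _), h.rank]
  have h1 := Finset.card_filter_add_card_filter_not (s := R) (Touches c q)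
  have h2 := h.left_card
  unfold classDeg at hq
  omega

/-- The vectors of `U`, and those of `R` that miss `q`, are killed by both functionals; dropping at
most one vector of `R` leaves corank at most two. -/
theorem close_ind {q : Q} (hq : classDeg c R q ≤ 1) : Close V (α ∘ c) (ind c q) := by
  refine (h.le_finrank_untouched hq).trans (Nat.add_le_add_right (finrank_mono_set ?_) 2)
  rintro v (hv | hv)
  · have h1 := (h.mem_common v).1 hv
    simp [h1.1, h1.2.1, h.dotL_ind_common q hv]
  · obtain ⟨hvR, hvq⟩ := Finset.mem_filter.1 (Finset.mem_coe.1 hv)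
    rw [Finset.mem_coe, Finset.mem_inter]
    exact ⟨h.left_sub hvR, mem_nullSet.2 ⟨h.left_mem hvR, not_not.1 hvq⟩⟩

/-- To the corank-two set of `U` and the vectors of `R` missing `q` one adds `w`: it also misses
`q`, and it is independent of them because `α` does not kill it. -/
theorem isNormal_ind {q : Q} (hq : classDeg c R q ≤ 1) (hqt : q ∈ touched c R B) {w : ι → ℝ}
    (hw : w ∈ B) (hqw : ¬ Touches c q w) : IsNormal V (ind c q) := by
  apply le_antisymm
  · rw [mem_touched] at hqt
    have hex : ∃ u ∈ V, Touches c q u := by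
      by_cases h0 : classDeg c R q = 0
      · obtain ⟨u, hu⟩ := Finset.card_pos.1 (Nat.pos_of_ne_zero (n := classDeg c B q) (by omega))
        exact ⟨u, h.symm.left_mem (Finset.mem_filter.1 hu).1, (Finset.mem_filter.1 hu).2⟩
      · obtain ⟨u, hu⟩ := Finset.card_pos.1 (Nat.pos_of_ne_zero h0)
        exact ⟨u, h.left_mem (Finset.mem_filter.1 hu).1, (Finset.mem_filter.1 hu).2⟩
    obtain ⟨u, hu, hqu⟩ := hex
    exact finrank_nullSet_lt hu hqu
  · have h1 := h.le_finrank_untouched hq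
    have h2 : Set.finrank ℝ
        ((U : Set (ι → ℝ)) ∪ (R.filter fun v => ¬ Touches c q v : Finset (ι → ℝ))) + 1 ≤
        Set.finrank ℝ (nullSet V (dotL (ind c q)) : Set (ι → ℝ)) := by
      refine finrank_lt_of_apply_ne_zero (f := (dotL (α ∘ c)).toLinearMap) ?_ ?_
        (w := w) (mem_nullSet.2 ⟨h.symm.left_mem hw, not_not.1 hqw⟩) (h.symm.right_ne_zero hw)
      · rintro v (hv | hv)
        · exact mem_nullSet.2 ⟨((h.mem_common v).1 hv).1, h.dotL_ind_common q hv⟩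
        · obtain ⟨hvR, hvq⟩ := Finset.mem_filter.1 (Finset.mem_coe.1 hv)
          exact mem_nullSet.2 ⟨h.left_mem hvR, not_not.1 hvq⟩
      · rintro v (hv | hv)
        · exact ((h.mem_common v).1 hv).2.1
        · exact (mem_nullSet.1 (h.left_sub (Finset.mem_filter.1 (Finset.mem_coe.1 hv)).1)).2
    omega

theorem exists_path_two {q : Q} (hR : classDeg c R q = 1) (hB : classDeg c B q = 1) :
    ∃ f, IsNormal V f ∧ Close V (α ∘ c) f ∧ Close V f (β ∘ c) := by
  have hw : ∃ w ∈ B, ¬ Touches c q w := by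
    by_contra! hall
    rw [classDeg, Finset.filter_true_of_mem hall, h.right_card] at hB
    have := h.two_le
    omega
  obtain ⟨w, hw, hqw⟩ := hw
  exact ⟨ind c q, h.isNormal_ind hR.le (by rw [mem_touched]; omega) hw hqw, h.close_ind hR.le,
    (h.symm.close_ind hB.le).symm⟩

section NoOneOne

variable (hno : ∀ q, ¬ (classDeg c R q = 1 ∧ classDeg c B q = 1))
include hno

/-- Every touched class is joined by a vector of `R` to a class on the other side of `β`. -/
theorem exists_left_neighbour {q : Q} (hq : q ∈ touched c R B) : ∃ v ∈ R, Touches c q v ∧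
    ∃ i j, (v = Pi.single i 1 - Pi.single j 1 ∨ v = Pi.single j 1 - Pi.single i 1) ∧ c i = q ∧
      β (c i) ≠ β (c j) ∧ c j ∈ touched c R B := by
  obtain ⟨v, hv⟩ := Finset.card_pos.1 (h.classDeg_left_pos hno hq)
  obtain ⟨hv, hqv⟩ := Finset.mem_filter.1 hv
  refine ⟨v, hv, hqv, ?_⟩
  obtain ⟨i, j, rfl, hα, hβ, hij⟩ := h.left_ends hv
  rcases (touches_iff hij).1 hqv with hi | hj
  · exact ⟨i, j, Or.inl rfl, hi, hβ, mem_touched_of_touches hv ((touches_iff hij).2 (Or.inr rfl))⟩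
  · exact ⟨j, i, Or.inr rfl, hj, hβ.symm,
      mem_touched_of_touches hv ((touches_iff hij).2 (Or.inl rfl))⟩

/-- A vector of `R` leads from `q` to a class on the other side of `β`, and a vector of `B` at that
class stays on that side. -/
theorem exists_right_not_touching {q : Q} (hq : q ∈ touched c R B) :
    ∃ w ∈ B, ¬ Touches c q w := by
  obtain ⟨v, -, -, i, j, -, rfl, hβ, hj⟩ := h.exists_left_neighbour hno hq
  obtain ⟨w, hw⟩ := Finset.card_pos.1 (h.classDeg_right_pos hno hj)
  obtain ⟨hw, hjw⟩ := Finset.mem_filter.1 hw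
  refine ⟨w, hw, fun hiw => hβ ?_⟩
  obtain ⟨x, y, rfl, hxy, -, hne⟩ := h.right_ends hw
  rw [touches_iff hne] at hiw hjw
  rcases hiw with hi | hi <;> rcases hjw with hj | hj <;> rw [← hi, ← hj] <;> simp [hxy]

/-- The degrees of `R` have sum `2 * k` over at least `k + 2` classes. -/
theorem exists_left_leaf : ∃ q ∈ touched c R B, classDeg c R q ≤ 1 := by
  by_contra! hcon
  have h1 := Finset.card_nsmul_le_sum _ (fun q => classDeg c R q) 2 hcon
  have h2 : ∑ q ∈ touched c R B, classDeg c R q ≤ ∑ q, classDeg c R q :=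
    Finset.sum_le_sum_of_subset (Finset.subset_univ _)
  rw [h.sum_univ] at h2
  have h3 := h.le_card_touched
  rw [smul_eq_mul] at h1
  omega

/-- On each side of `β` there is a class touched by exactly one vector of `B`. -/
theorem exists_right_leaf {p : Q} (hp : p ∈ touched c R B) :
    ∃ q ∈ touched c R B, β q = β p ∧ classDeg c B q ≤ 1 := by
  classical
  by_contra! hcon
  set T := (touched c R B).filter fun q => β q = β p with hT
  have hpT : p ∈ T := Finset.mem_filter.2 ⟨hp, rfl⟩
  have h1 := Finset.card_nsmul_le_sum T (fun q => classDeg c B q) 2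
    fun q hq => hcon q (Finset.mem_filter.1 hq).1 (Finset.mem_filter.1 hq).2
  -- As `β` is constant along `B`, these edges have both ends in `T`. They form a forest there, so
  -- `F.card < T.card`, and the degree sum `2 * F.card` is too small for all degrees to be at least
  -- two.
  set F := B.filter fun v => ∃ q ∈ T, Touches c q v with hF
  have hends : ∀ v ∈ F, ∃ i j, v = Pi.single i 1 - Pi.single j 1 ∧ c i ∈ T ∧ c j ∈ T := by
    intro v hv
    obtain ⟨hv, q, hq, hqv⟩ := Finset.mem_filter.1 hv
    obtain ⟨i, j, rfl, hβ, -, hij⟩ := h.right_ends hv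
    have hi : c i ∈ touched c R B := by
      rw [← touched_comm]
      exact mem_touched_of_touches hv ((touches_iff hij).2 (Or.inl rfl))
    have hj : c j ∈ touched c R B := by
      rw [← touched_comm]
      exact mem_touched_of_touches hv ((touches_iff hij).2 (Or.inr rfl))
    have hqβ := (Finset.mem_filter.1 hq).2
    refine ⟨i, j, rfl, Finset.mem_filter.2 ⟨hi, ?_⟩, Finset.mem_filter.2 ⟨hj, ?_⟩⟩
    · rcases (touches_iff hij).1 hqv with rfl | rfl
      · exact hqβ
      · rw [hβ, hqβ]
    · rcases (touches_iff hij).1 hqv with rfl | rfl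
      · rw [← hβ, hqβ]
      · exact hqβ
  have h2 : ∑ q ∈ T, classDeg c B q ≤ 2 * F.card := by
    rw [sum_classDeg, ← Finset.sum_filter_add_sum_filter_not B (fun v => ∃ q ∈ T, Touches c q v)]
    have h0 : ∑ v ∈ B with ¬ ∃ q ∈ T, Touches c q v,
        (T.filter fun q => Touches c q v).card = 0 := by
      refine Finset.sum_eq_zero fun v hv => ?_
      rw [Finset.card_eq_zero, Finset.filter_eq_empty_iff]
      intro q hq hqv
      exact (Finset.mem_filter.1 hv).2 ⟨q, hq, hqv⟩
    rw [h0, add_zero]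
    refine (Finset.sum_le_card_nsmul _ _ 2 fun v hv =>
      h.symm.card_touching (Finset.mem_filter.1 hv).1 T).trans_eq ?_
    rw [smul_eq_mul, mul_comm]
  obtain ⟨w, hw⟩ := Finset.card_pos.1 (h.classDeg_right_pos hno hp)
  obtain ⟨hw, hpw⟩ := Finset.mem_filter.1 hw
  obtain ⟨i, -, -, hi, -⟩ := hends w (Finset.mem_filter.2 ⟨hw, p, hpT, hpw⟩)
  have h3 := finrank_union_lt h.mem_span ⟨i, hi⟩ hends
  rw [h.right_independent (F := F) (Finset.filter_subset _ _)] at h3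
  rw [smul_eq_mul] at h1
  omega

/-- The indicators of two classes on the same side of `β` are normals of facets in one belt. -/
theorem close_ind_ind {p q : Q} (hpq : p ≠ q) (hβ : β q = β p) :
    Close V (ind c p) (ind c q) := by
  refine finrank_le_add_two (f := (dotL (ind c p)).toLinearMap) (g := (dotL (ind c q)).toLinearMap)
    fun φ hφ => ?_
  -- It remains to see that an `f` killing every vector of `V` that touches neither `p` nor `q` is,
  -- on `V`, a combination of the indicators of `p` and `q`.
  obtain ⟨f, hf⟩ := exists_eq_dotL φ
  simp only [hf] at hφ ⊢
  simp only [ContinuousLinearMap.coe_coe]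
  have hfU : ∀ v ∈ U, dotL f v = 0 := fun v hv => hφ v (by
    have := ((h.mem_common v).1 hv).1
    simp [this, h.dotL_ind_common _ hv])
  have hfree : ∀ v ∈ V, ¬ Touches c p v → ¬ Touches c q v → dotL f v = 0 := fun v hv h1 h2 =>
    hφ v (by simp [hv, not_not.1 h1, not_not.1 h2])
  -- the part of `f` on the side of `β` not containing `p` and `q`
  obtain ⟨x, hx⟩ : ∃ x : ℝ, ∀ v ∈ V,
      dotL (fun i => if β (c i) = β p then 0 else f i - x) v = 0 := by
    -- A vector killed by `β` stays on one side of it, and on the far side it misses `p` and `q`.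
    -- Hence `f` cut off to the far side kills `U` and `B`, and is a multiple of `β` on `V`.
    have hkill : ∀ v ∈ V, (dotL (β ∘ c) v = 0 → dotL f v = 0 ∨ Touches c p v ∨ Touches c q v) →
        dotL (β ∘ c) v = 0 → dotL (fun i => if β (c i) = β p then 0 else f i) v = 0 := by
      intro v hv himp h0
      have h1 := himp h0
      obtain ⟨i, j, -, rfl⟩ := h.root v hv
      rw [dotL_single_sub_single, sub_eq_zero] at h0
      change β (c i) = β (c j) at h0
      by_cases hi : β (c i) = β p
      · simp [hi, ← h0]
      · have hip : c i ≠ p := fun h => hi (by rw [h])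
        have hjp : c j ≠ p := fun h => hi (by rw [h0, h])
        have hiq : c i ≠ q := fun h => hi (by rw [h, hβ])
        have hjq : c j ≠ q := fun h => hi (by rw [h0, h, hβ])
        simp only [Touches, dotL_single_sub_single, ind, hip, hjp, hiq, hjq, if_false, sub_self,
          ne_eq, not_true, or_false] at h1
        simp [hi, ← h0, h1]
    obtain ⟨x, hx⟩ := h.symm.exists_eq_mul_left
      (f := fun i => if β (c i) = β p then 0 else f i)
      (fun v hv => hkill v ((h.mem_common v).1 hv).1 (fun _ => Or.inl (hfU v hv))
        ((h.mem_common v).1 hv).2.2)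
      (fun v hv => hkill v (h.symm.left_mem hv) (fun _ => by
        by_contra! hcon
        exact hcon.1 (hfree v (h.symm.left_mem hv) hcon.2.1 hcon.2.2))
        (mem_nullSet.1 (h.right_sub hv)).2)
    -- The indicator of the far side is `β` or `1 - β` according to the value `β p`; hence the sign.
    refine ⟨if β p = 0 then x else -x, fun v hv => ?_⟩
    have h1 := hx v hv
    obtain ⟨i, j, -, rfl⟩ := h.root v hv
    rw [dotL_single_sub_single] at h1 ⊢
    rw [dotL_single_sub_single] at h1
    simp only [Function.comp] at h1
    rcases h.right_indicator p with hp | hp <;> rcases h.right_indicator (c i) with hi | hi <;>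
    rcases h.right_indicator (c j) with hj | hj <;> simp [hp, hi, hj] at h1 ⊢ <;> linarith
  -- `f` equals `x` on all touched classes of the side of `p` and `q` but these two
  have hval : ∀ i, c i ∈ touched c R B → β (c i) = β p → c i ≠ p → c i ≠ q → f i = x := by
    intro i hi hiβ hip hiq
    -- The vector of `R` from this class to the far side avoids `p` and `q`, so it carries the value
    -- `x` across.
    obtain ⟨v, hv, -, i', j, hvij, hi', hne, -⟩ := h.exists_left_neighbour hno hi
    have hii' := h.apply_eq_of_class_eq hfU hi'
    rw [hi'] at hne
    have hjp : c j ≠ p := fun h => hne (by rw [h, hiβ])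
    have hjq : c j ≠ q := fun h => hne (by rw [h, hβ, hiβ])
    have hjβ : ¬ β (c j) = β p := fun h => hne (by rw [h, hiβ])
    have h1 := hx v (h.left_mem hv)
    have h2 : dotL f v = 0 := by
      refine hfree v (h.left_mem hv) ?_ ?_ <;> rcases hvij with rfl | rfl <;>
      simp [Touches, ind, hi', hip, hiq, hjp, hjq]
    rcases hvij with rfl | rfl <;> rw [dotL_single_sub_single] at h1 h2 <;>
    simp [hi', hiβ, hjβ] at h1 <;> linarith
  obtain ⟨y, hy⟩ : ∃ y, ∀ i, c i = p → f i = y := by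
    by_cases hex : ∃ i, c i = p
    · obtain ⟨i, hi⟩ := hex
      exact ⟨f i, fun j hj => h.apply_eq_of_class_eq hfU (hj.trans hi.symm)⟩
    · exact ⟨0, fun i hi => absurd ⟨i, hi⟩ hex⟩
  obtain ⟨z, hz⟩ : ∃ z, ∀ i, c i = q → f i = z := by
    by_cases hex : ∃ i, c i = q
    · obtain ⟨i, hi⟩ := hex
      exact ⟨f i, fun j hj => h.apply_eq_of_class_eq hfU (hj.trans hi.symm)⟩
    · exact ⟨0, fun i hi => absurd ⟨i, hi⟩ hex⟩
  refine ⟨y - x, z - x, ?_⟩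
  -- what remains vanishes on `U`, `R` and `B`
  have hg : ∀ v ∈ V, dotL (fun i => if β (c i) = β p then
      f i - x - (y - x) * ind c p i - (z - x) * ind c q i else 0) v = 0 := by
    have hends : ∀ i, c i ∈ touched c R B → (if β (c i) = β p then
        f i - x - (y - x) * ind c p i - (z - x) * ind c q i else 0) = 0 := by
      intro i hi
      split_ifs with hiβ
      · by_cases hip : c i = p
        · simp [ind, hip, hpq, hy i hip]
        · by_cases hiq : c i = q
          · simp [ind, hiq, hpq.symm, hz i hiq]
          · simp [ind, hip, hiq, hval i hi hiβ hip hiq]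
      · rfl
    refine h.dotL_eq_zero (fun v hv => ?_) (fun v hv => ?_) (fun v hv => ?_)
    · obtain ⟨i, j, -, rfl⟩ := h.root v ((h.mem_common v).1 hv).1
      have hij := h.eq_class i j hv
      rw [dotL_single_sub_single]
      simp [ind, hij, h.apply_eq_of_class_eq hfU hij]
    · obtain ⟨i, j, rfl, hi, hj⟩ := h.ends_mem_touched hv
      rw [dotL_single_sub_single, hends i hi, hends j hj, sub_zero]
    · obtain ⟨i, j, rfl, hi, hj⟩ := h.symm.ends_mem_touched hv
      rw [touched_comm] at hi hj
      rw [dotL_single_sub_single, hends i hi, hends j hj, sub_zero]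
  intro v hv
  have h1 := hx v hv
  have h2 := hg v hv
  obtain ⟨i, j, -, rfl⟩ := h.root v hv
  rw [dotL_single_sub_single] at h1 h2 ⊢
  rw [dotL_single_sub_single, dotL_single_sub_single]
  have hz : ∀ i, ¬ β (c i) = β p → ind c p i = 0 ∧ ind c q i = 0 := by
    intro i hi
    have hip : c i ≠ p := fun h => hi (by rw [h])
    have hiq : c i ≠ q := fun h => hi (by rw [h, hβ])
    simp [ind, hip, hiq]
  by_cases hi : β (c i) = β p <;> by_cases hj : β (c j) = β p <;>
  simp only [hi, hj, if_true, if_false] at h1 h2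
  · linarith
  · rw [(hz j hj).1, (hz j hj).2]; linarith
  · rw [(hz i hi).1, (hz i hi).2]; linarith
  · rw [(hz j hj).1, (hz j hj).2, (hz i hi).1, (hz i hi).2]; linarith

end NoOneOne

/-- Without a class of type (1, 1), a leaf `p` of `R` and a leaf `q` of `B` on the same side of `β`
are distinct, since all degrees are at least three. Their stars are the two intermediate facets. -/
theorem exists_path_three : ∃ f g, IsNormal V f ∧ IsNormal V g ∧ Close V (α ∘ c) f ∧
    Close V f g ∧ Close V g (β ∘ c) := by
  by_cases hno : ∀ q, ¬ (classDeg c R q = 1 ∧ classDeg c B q = 1)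
  · obtain ⟨p, hp, hpR⟩ := h.exists_left_leaf hno
    obtain ⟨q, hq, hβ, hqB⟩ := h.exists_right_leaf hno hp
    have hpq : p ≠ q := by
      rintro rfl
      have h1 := h.three_le_deg hno hp
      omega
    have hno' : ∀ q, ¬ (classDeg c B q = 1 ∧ classDeg c R q = 1) := fun q hq => hno q hq.symm
    have hq' := hq
    rw [← touched_comm] at hq'
    obtain ⟨w, hw, hpw⟩ := h.exists_right_not_touching hno hp
    obtain ⟨v, hv, hqv⟩ := h.symm.exists_right_not_touching hno' hq'
    exact ⟨ind c p, ind c q, h.isNormal_ind hpR hp hw hpw, h.symm.isNormal_ind hqB hq' hv hqv,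
      h.close_ind hpR, h.close_ind_ind hno hpq hβ, (h.symm.close_ind hqB).symm⟩
  · push Not at hno
    obtain ⟨q, hR, hB⟩ := hno
    obtain ⟨f, hf, h1, h2⟩ := h.exists_path_two hR hB
    refine ⟨f, f, hf, hf, h1, ?_, h2⟩
    rw [Close, Finset.inter_self, ← hf]
    omega

end Config

end Paths

universe u

/-! ### Upper bounds for belt distances -/

section UpperBounds

variable {ι : Type*} [Fintype ι] [DecidableEq ι]

theorem finrank_union_le {E : Type*} [AddCommGroup E] [Module ℝ E] [FiniteDimensional ℝ E]
    (S T : Set E) : Set.finrank ℝ (S ∪ T) ≤ Set.finrank ℝ S + Set.finrank ℝ T := by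
  unfold Set.finrank
  rw [Submodule.span_union]
  exact Submodule.finrank_add_le_finrank_add_finrank _ _

/-- Two coordinates are equivalent if `U` connects them. -/
def classSetoid (U : Finset (ι → ℝ)) : Setoid ι where
  r i j := (Pi.single i 1 - Pi.single j 1 : ι → ℝ) ∈ Submodule.span ℝ (U : Set (ι → ℝ))
  iseqv := by
    refine ⟨fun i => by simp, fun {i j} hij => ?_, fun {i j k} hij hjk => ?_⟩
    · simpa using Submodule.neg_mem _ hij
    · simpa using Submodule.add_mem _ hij hjk

theorem exists_config {ι : Type u} [Fintype ι] [DecidableEq ι] {V : Finset (ι → ℝ)}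
    (hV : ∀ v ∈ V, IsRoot v) {a b : ι → ℝ} (ha : ∀ i, a i = 0 ∨ a i = 1) (hb : ∀ i, b i = 0 ∨ b i = 1) (hna : IsNormal V a)
    (hnb : IsNormal V b) (hab : ¬ Close V a b) :
    ∃ (Q : Type u) (_ : Fintype Q) (_ : DecidableEq Q) (U R B : Finset (ι → ℝ)) (c : ι → Q)
      (α β : Q → ℝ) (k : ℕ), α ∘ c = a ∧ β ∘ c = b ∧ Config V U R B c α β k := by
  classical
  set U := nullSet V (dotL a) ∩ nullSet V (dotL b) with hU
  have hUa : (U : Set (ι → ℝ)) ⊆ nullSet V (dotL a) := by simp [hU]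
  have hUb : (U : Set (ι → ℝ)) ⊆ nullSet V (dotL b) := by simp [hU]
  obtain ⟨R, hR, hR1, hR2⟩ := exists_finset_extension hUa
  obtain ⟨B, hB, hB1, hB2⟩ := exists_finset_extension hUb
  -- A functional killing `U` is constant on classes, so `a` and `b` descend to the quotient.
  have hout : ∀ f : ι → ℝ, (∀ v ∈ U, dotL f v = 0) →
      (fun q : Quotient (classSetoid U) => f q.out) ∘ Quotient.mk _ = f := by
    intro f hf
    funext i
    have h1 : Submodule.span ℝ (U : Set (ι → ℝ)) ≤ LinearMap.ker (dotL f).toLinearMap :=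
      Submodule.span_le.2 hf
    have h2 : (Pi.single (Quotient.mk (classSetoid U) i).out 1 - Pi.single i 1 : ι → ℝ) ∈
        Submodule.span ℝ (U : Set (ι → ℝ)) := Quotient.mk_out (s := classSetoid U) i
    have h3 := h1 h2
    simpa [sub_eq_zero] using h3
  have hca := hout a fun v hv => (mem_nullSet.1 (hUa hv)).2
  have hcb := hout b fun v hv => (mem_nullSet.1 (hUb hv)).2
  unfold Close at hab
  unfold IsNormal at hna hnb
  rw [← hU] at hab
  refine ⟨Quotient (classSetoid U), inferInstance, inferInstance, U, R, B, Quotient.mk _, _, _,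
    R.card, hca, hcb, ?_⟩
  exact
  { root := hV
    left_indicator := fun q => ha _
    right_indicator := fun q => hb _
    mem_common := fun v => by
      rw [hca, hcb]
      simp only [hU, Finset.mem_inter, mem_nullSet]
      tauto
    mem_span := fun i j hij => Quotient.exact hij
    eq_class := fun i j hij => Quotient.sound (Submodule.subset_span hij)
    left_sub := by rw [hca]; exact hR
    right_sub := by rw [hcb]; exact hB
    left_card := rfl
    right_card := by omega
    left_rank := by omega
    right_rank := by omega
    rank := by omega
    two_le := by omega }

/-- The number of vectors of `F` with nonzero coordinate `i`. -/
noncomputable def coordDeg (F : Finset (ι → ℝ)) (i : ι) : ℕ := (F.filter fun v => v i ≠ 0).card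

/-- Double counting: every edge has exactly one end of each colour of `σ`. -/
theorem sum_coordDeg {F : Finset (ι → ℝ)} {σ : ι → Bool} (s : Bool)
    (hF : ∀ v ∈ F, ∃ i j, v = Pi.single i 1 - Pi.single j 1 ∧ σ i ≠ σ j) :
    ∑ i with σ i = s, coordDeg F i = F.card := by
  have h1 : ∑ i with σ i = s, coordDeg F i =
      ∑ v ∈ F, ((Finset.univ.filter fun i => σ i = s).filter fun i => v i ≠ 0).card := by
    simp only [coordDeg, Finset.card_filter]
    exact Finset.sum_comm
  rw [h1, Finset.card_eq_sum_ones]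
  refine Finset.sum_congr rfl fun v hv => ?_
  obtain ⟨i, j, rfl, hij⟩ := hF v hv
  have hne : i ≠ j := fun h => hij (by rw [h])
  have hsupp : ∀ k, (Pi.single i 1 - Pi.single j 1 : ι → ℝ) k ≠ 0 ↔ k = i ∨ k = j := by
    intro k
    by_cases hki : k = i
    · subst hki; simp [hne]
    · by_cases hkj : k = j
      · subst hkj; simp [hki]
      · simp [hki, hkj]
  rw [Finset.card_eq_one]
  simp only [hsupp]
  by_cases hi : σ i = s
  · refine ⟨i, Finset.ext fun k => ?_⟩
    simp only [Finset.mem_filter, Finset.mem_univ, true_and, Finset.mem_singleton]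
    constructor
    · rintro ⟨hk, rfl | rfl⟩
      · rfl
      · exact absurd (hi.trans hk.symm) hij
    · rintro rfl; exact ⟨hi, Or.inl rfl⟩
  · refine ⟨j, Finset.ext fun k => ?_⟩
    simp only [Finset.mem_filter, Finset.mem_univ, true_and, Finset.mem_singleton]
    constructor
    · rintro ⟨hk, rfl | rfl⟩
      · exact absurd hk hi
      · rfl
    · rintro rfl
      refine ⟨?_, Or.inr rfl⟩
      cases h1 : σ i <;> cases h2 : σ k <;> cases s <;> simp_all

namespace Config

variable {Q : Type*} [Fintype Q] [DecidableEq Q]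
variable {V U R B : Finset (ι → ℝ)} {c : ι → Q} {α β : Q → ℝ} {k : ℕ}

/-- If a common zone vector `e_u - e_v` spans `U`, the class degrees split as coordinate degrees. -/
theorem classDeg_eq_coordDeg (h : Config V U R B c α β k) {u v : ι} (huv : u ≠ v)
    (hU : Submodule.span ℝ (U : Set (ι → ℝ)) =
      Submodule.span ℝ {(Pi.single u 1 - Pi.single v 1 : ι → ℝ)}) :
    (∀ i, i ≠ u → i ≠ v → coordDeg R i = classDeg c R (c i)) ∧
      coordDeg R u + coordDeg R v = classDeg c R (c u) := by
  -- The only class with more than one element is `{u, v}`, because `e_i - e_j` must be a multiple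
  -- of `e_u - e_v`.
  have hclass : ∀ i j, c i = c j → i ≠ j → (i = u ∨ i = v) ∧ (j = u ∨ j = v) := by
    intro i j hij hne
    have h1 := h.mem_span i j hij
    rw [hU, Submodule.mem_span_singleton] at h1
    obtain ⟨s, hs⟩ := h1
    have hi := congrFun hs i
    have hj := congrFun hs j
    constructor
    · by_contra! hcon
      simp [hcon.1, hcon.2, hne] at hi
    · by_contra! hcon
      simp [hcon.1, hcon.2, hne.symm] at hj
  have hcuv : c u = c v := by
    have hmem : (Pi.single u 1 - Pi.single v 1 : ι → ℝ) ∈ Submodule.span ℝ (U : Set (ι → ℝ)) := by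
      rw [hU]; exact Submodule.mem_span_singleton_self _
    have h1 : Submodule.span ℝ (U : Set (ι → ℝ)) ≤
        LinearMap.ker (dotL (ind c (c u))).toLinearMap :=
      Submodule.span_le.2 fun w hw => h.dotL_ind_common _ hw
    have h2 := h1 hmem
    by_contra hne
    simp [ind, Ne.symm hne] at h2
  have hsupp : ∀ i j : ι, i ≠ j → ∀ k, (Pi.single i 1 - Pi.single j 1 : ι → ℝ) k ≠ 0 ↔
      i = k ∨ j = k := by
    intro i j hne k
    by_cases hki : k = i
    · subst hki; simp [hne]
    · by_cases hkj : k = j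
      · subst hkj; simp [hki]
      · simp [hki, hkj, Ne.symm hki, Ne.symm hkj]
  constructor
  · intro i hiu hiv
    unfold coordDeg classDeg
    congr 1
    refine Finset.filter_congr fun w hw => ?_
    obtain ⟨x, y, rfl, -, -, hxy⟩ := h.left_ends hw
    rw [hsupp x y (fun h => hxy (by rw [h])), touches_iff hxy]
    have hone : ∀ x, c x = c i ↔ x = i := by
      refine fun x => ⟨fun hx => ?_, fun hx => by rw [hx]⟩
      by_contra hne
      rcases (hclass x i hx hne).2 with h | h
      · exact hiu h
      · exact hiv h
    rw [hone, hone]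
  · unfold coordDeg classDeg
    rw [← Finset.card_union_of_disjoint, ← Finset.filter_or]
    · congr 1
      refine Finset.filter_congr fun w hw => ?_
      obtain ⟨x, y, rfl, -, -, hxy⟩ := h.left_ends hw
      have hxy' : x ≠ y := fun h => hxy (by rw [h])
      rw [hsupp x y hxy', hsupp x y hxy', touches_iff hxy]
      have htwo : ∀ x, c x = c u ↔ x = u ∨ x = v := by
        refine fun x => ⟨fun hx => ?_, ?_⟩
        · by_contra! hne
          rcases (hclass x u hx hne.1).1 with h | h
          · exact hne.1 h
          · exact hne.2 h
        · rintro (rfl | rfl)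
          · rfl
          · exact hcuv.symm
      rw [htwo, htwo]
      tauto
    · rw [Finset.disjoint_filter]
      intro w hw hwu hwv
      obtain ⟨x, y, rfl, -, -, hxy⟩ := h.left_ends hw
      have hxy' : x ≠ y := fun h => hxy (by rw [h])
      rw [hsupp x y hxy'] at hwu hwv
      rcases hwu with rfl | rfl <;> rcases hwv with rfl | rfl
      · exact huv rfl
      · exact hxy hcuv
      · exact hxy hcuv.symm
      · exact huv rfl

/-- If all vectors of `R` and `B` avoid a coordinate `u`, this coordinate gives a facet normal. -/
theorem path_of_coordDeg_eq_zero (h : Config V U R B c α β k)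
    (hU : Set.finrank ℝ (U : Set (ι → ℝ)) = 1) {u v : ι} (huv : u ≠ v)
    (hmem : (Pi.single u 1 - Pi.single v 1 : ι → ℝ) ∈ V ∨
      (Pi.single v 1 - Pi.single u 1 : ι → ℝ) ∈ V)
    (h0 : coordDeg R u + coordDeg B u = 0) :
    IsNormal V (Pi.single u 1) ∧ Close V (α ∘ c) (Pi.single u 1) ∧
      Close V (Pi.single u 1) (β ∘ c) := by
  have hzero : ∀ {R B : Finset (ι → ℝ)} {α β}, Config V U R B c α β k → coordDeg R u = 0 →
      ∀ w ∈ R, w ∈ nullSet V (dotL (Pi.single u 1)) := by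
    intro R B α β h h0 w hw
    rw [coordDeg, Finset.card_eq_zero, Finset.filter_eq_empty_iff] at h0
    refine mem_nullSet.2 ⟨h.left_mem hw, ?_⟩
    have := not_not.1 (h0 hw)
    simp [dotL_apply, Pi.single_apply, this]
  have hclose : ∀ {R B : Finset (ι → ℝ)} {α β}, Config V U R B c α β k → coordDeg R u = 0 →
      Close V (α ∘ c) (Pi.single u 1) := by
    intro R B α β h h0
    -- As `U` has rank one, `R` alone has rank at least `k`, two less than `V`, and it is killed by
    -- both functionals.
    have h1 := finrank_union_le (U : Set (ι → ℝ)) R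
    rw [h.left_rank] at h1
    have h2 : Set.finrank ℝ (R : Set (ι → ℝ)) ≤ Set.finrank ℝ ((nullSet V (dotL (α ∘ c)) ∩
        nullSet V (dotL (Pi.single u 1)) : Finset (ι → ℝ)) : Set (ι → ℝ)) :=
      finrank_mono_set fun w hw => by
        rw [Finset.mem_coe, Finset.mem_inter]
        exact ⟨h.left_sub hw, hzero h h0 w hw⟩
    rw [Close, h.rank]
    omega
  refine ⟨le_antisymm ?_ ?_, hclose h (by omega), (hclose h.symm (by omega)).symm⟩
  · rcases hmem with hmem | hmem
    · exact finrank_nullSet_lt hmem (by simp [huv])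
    · exact finrank_nullSet_lt hmem (by simp [huv])
  · have h1 := finrank_union_le (U : Set (ι → ℝ)) ((R : Set (ι → ℝ)) ∪ B)
    have h2 : Set.finrank ℝ ((U : Set (ι → ℝ)) ∪ (R ∪ B)) = Set.finrank ℝ (V : Set (ι → ℝ)) := by
      rw [← Set.union_assoc]
      unfold Set.finrank
      rw [h.span_eq]
    have h3 : Set.finrank ℝ ((R : Set (ι → ℝ)) ∪ B) ≤
        Set.finrank ℝ (nullSet V (dotL (Pi.single u 1)) : Set (ι → ℝ)) := by
      refine finrank_mono_set ?_
      rintro w (hw | hw)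
      · exact hzero h (by omega) w hw
      · exact hzero h.symm (by omega) w hw
    omega

/-- In a bipartite configuration with `k = 6` and `U` of rank one, if all class degrees are three,
there is a common neighbour. -/
theorem exists_path_two_of_cubic (h : Config V U R B c α β 6)
    (hU : Set.finrank ℝ (U : Set (ι → ℝ)) = 1) {σ : ι → Bool}
    (hσ : ∀ i j, (Pi.single i 1 - Pi.single j 1 : ι → ℝ) ∈ V → σ i ≠ σ j)
    (hdeg : ∀ q ∈ touched c R B, classDeg c R q + classDeg c B q = 3) :
    ∃ f, IsNormal V f ∧ Close V (α ∘ c) f ∧ Close V f (β ∘ c) := by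
  have hne : U.Nonempty := by
    rw [Finset.nonempty_iff_ne_empty]
    rintro rfl
    rw [Finset.coe_empty, Set.finrank_empty] at hU
    omega
  obtain ⟨e, he⟩ := hne
  have heV := ((h.mem_common e).1 he).1
  obtain ⟨u, v, huv, rfl⟩ := h.root e heV
  have hspan : Submodule.span ℝ (U : Set (ι → ℝ)) =
      Submodule.span ℝ {(Pi.single u 1 - Pi.single v 1 : ι → ℝ)} := by
    symm
    apply span_eq_of_finrank_le (by simpa using he)
    rw [hU, Set.finrank, finrank_span_singleton (h.root _ heV).ne_zero]
  have hdeg3 : ∀ q, classDeg c R q + classDeg c B q = 0 ∨ classDeg c R q + classDeg c B q = 3 := by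
    intro q
    by_cases hq : q ∈ touched c R B
    · exact Or.inr (hdeg q hq)
    · rw [mem_touched, not_not] at hq
      exact Or.inl hq
  obtain ⟨hR1, hR2⟩ := h.classDeg_eq_coordDeg huv hspan
  obtain ⟨hB1, hB2⟩ := h.symm.classDeg_eq_coordDeg huv hspan
  have hother : ∀ i, i ≠ u → i ≠ v → 3 ∣ coordDeg R i + coordDeg B i := by
    intro i hiu hiv
    rw [hR1 i hiu hiv, hB1 i hiu hiv]
    rcases hdeg3 (c i) with h | h <;> rw [h] <;> norm_num
  have hsum : ∀ s, ∑ i with σ i = s, (coordDeg R i + coordDeg B i) = 12 := by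
    intro s
    rw [Finset.sum_add_distrib, sum_coordDeg s, sum_coordDeg s, h.left_card, h.right_card]
    · intro w hw
      obtain ⟨i, j, -, rfl⟩ := h.root w (h.symm.left_mem hw)
      exact ⟨i, j, rfl, hσ i j (h.symm.left_mem hw)⟩
    · intro w hw
      obtain ⟨i, j, -, rfl⟩ := h.root w (h.left_mem hw)
      exact ⟨i, j, rfl, hσ i j (h.left_mem hw)⟩
  have huvσ := hσ u v heV
  -- The degrees on the side of `x` add up to 12, and all but that of `x` are multiples of three.
  have hdvd : ∀ x y, σ x ≠ σ y → (∀ i, i ≠ x → i ≠ y → 3 ∣ coordDeg R i + coordDeg B i) →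
      3 ∣ coordDeg R x + coordDeg B x := by
    intro x y hxy hoth
    have h1 := Finset.add_sum_erase (Finset.univ.filter fun i => σ i = σ x)
      (fun i => coordDeg R i + coordDeg B i) (a := x) (by simp)
    rw [hsum] at h1
    have h2 : 3 ∣ ∑ i ∈ (Finset.univ.filter fun i => σ i = σ x).erase x,
        (coordDeg R i + coordDeg B i) := by
      refine Finset.dvd_sum fun i hi => ?_
      simp only [Finset.mem_erase, Finset.mem_filter, Finset.mem_univ, true_and] at hi
      exact hoth i hi.1 fun h => hxy (by rw [← hi.2, h])
    omega
  have hu := hdvd u v huvσ hother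
  have hv := hdvd v u huvσ.symm fun i hiv hiu => hother i hiu hiv
  -- The degrees of `u` and `v` are multiples of three with sum 0 or 3, so one of them is zero.
  have htot := hdeg3 (c u)
  by_cases hu0 : coordDeg R u + coordDeg B u = 0
  · exact ⟨_, h.path_of_coordDeg_eq_zero hU huv (Or.inl heV) hu0⟩
  · exact ⟨_, h.path_of_coordDeg_eq_zero hU huv.symm (Or.inr heV) (by omega)⟩

end Config

variable {V : Finset (ι → ℝ)}

theorem Close.congr {f g f' g' : ι → ℝ} (h : Close V f g)
    (hf : nullSet V (dotL f') = nullSet V (dotL f))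
    (hg : nullSet V (dotL g') = nullSet V (dotL g)) :
    Close V f' g' := by
  rwa [Close, hf, hg]

theorem IsNormal.close_self {f : ι → ℝ} (h : IsNormal V f) : Close V f f := by
  rw [Close, Finset.inter_self, ← h]
  omega

theorem exists_path_three (hV : ∀ v ∈ V, IsRoot v) {f g : ι → ℝ} (hf : IsNormal V f)
    (hg : IsNormal V g) :
    ∃ f' g', IsNormal V f' ∧ IsNormal V g' ∧ Close V f f' ∧ Close V f' g' ∧ Close V g' g := by
  obtain ⟨a, ha, hfa⟩ := exists_indicator hV hf
  obtain ⟨b, hb, hgb⟩ := exists_indicator hV hg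
  have hna := hf.of_nullSet_eq hfa
  have hnb := hg.of_nullSet_eq hgb
  by_cases hab : Close V a b
  · exact ⟨f, g, hf, hg, hf.close_self, hab.congr hfa.symm hgb.symm, hg.close_self⟩
  · obtain ⟨Q, _, _, U, R, B, c, α, β, k, rfl, rfl, h⟩ := exists_config hV ha hb hna hnb hab
    obtain ⟨f', g', hf', hg', h1, h2, h3⟩ := h.exists_path_three
    exact ⟨f', g', hf', hg', h1.congr hfa.symm rfl, h2, h3.congr rfl hgb.symm⟩

theorem exists_path_two (hV : ∀ v ∈ V, IsRoot v) {f g : ι → ℝ} (hf : IsNormal V f)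
    (hg : IsNormal V g) (hd : Set.finrank ℝ (V : Set (ι → ℝ)) ≤ 6 ∨
      Set.finrank ℝ (V : Set (ι → ℝ)) = 8 ∧ ∃ σ : ι → Bool,
        ∀ i j, (Pi.single i 1 - Pi.single j 1 : ι → ℝ) ∈ V → σ i ≠ σ j) :
    ∃ f', IsNormal V f' ∧ Close V f f' ∧ Close V f' g := by
  obtain ⟨a, ha, hfa⟩ := exists_indicator hV hf
  obtain ⟨b, hb, hgb⟩ := exists_indicator hV hg
  have hna := hf.of_nullSet_eq hfa
  have hnb := hg.of_nullSet_eq hgb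
  by_cases hab : Close V a b
  · exact ⟨f, hf, hf.close_self, hab.congr hfa.symm hgb.symm⟩
  · obtain ⟨Q, _, _, U, R, B, c, α, β, k, rfl, rfl, h⟩ := exists_config hV ha hb hna hnb hab
    have hex : ∃ f', IsNormal V f' ∧ Close V (α ∘ c) f' ∧ Close V f' (β ∘ c) := by
      by_cases hno : ∀ q, ¬ (classDeg c R q = 1 ∧ classDeg c B q = 1)
      · obtain ⟨h1, h2, h3⟩ := h.size_bound hno
        have hr := h.rank
        -- Since `rank V = rank U + k + 1` with `k ≥ 6` and `k ≠ 7`, rank at most six is impossible,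
        -- and rank eight leaves only `k = 6` with `U` of rank one.
        rcases hd with hd | ⟨hd, σ, hσ⟩
        · omega
        · obtain rfl : k = 6 := by omega
          exact h.exists_path_two_of_cubic (by omega) hσ (h3 rfl)
      · push Not at hno
        obtain ⟨q, hR, hB⟩ := hno
        exact h.exists_path_two hR hB
    obtain ⟨f', hf', h1, h2⟩ := hex
    exact ⟨f', hf', h1.congr hfa.symm rfl, h2.congr rfl hgb.symm⟩

theorem FacetPair.exists_isNormal (P : FacetPair V) :
    ∃ f, ∃ hf : IsNormal V f, P = facetPair V (dotL f) hf := by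
  obtain ⟨l, hl, rfl⟩ := FacetPair.exists_eq V P
  obtain ⟨f, hf⟩ := exists_eq_dotL l.toLinearMap
  obtain rfl : l = dotL f := ContinuousLinearMap.ext hf
  exact ⟨f, hl, rfl⟩

theorem beltDist_le_three (hV : ∀ v ∈ V, IsRoot v) (P Q : FacetPair V) : beltDist V P Q ≤ 3 := by
  obtain ⟨f, hf, rfl⟩ := P.exists_isNormal
  obtain ⟨g, hg, rfl⟩ := Q.exists_isNormal
  obtain ⟨f', g', hf', hg', h1, h2, h3⟩ := exists_path_three hV hf hg
  calc _ ≤ _ + _ := beltDist_triangle _ (facetPair V (dotL f') hf') _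
    _ ≤ _ + (_ + _) := by gcongr; exact beltDist_triangle _ (facetPair V (dotL g') hg') _
    _ ≤ 1 + (1 + 1) := by
      gcongr
      · exact beltDist_le_one _ _ h1
      · exact beltDist_le_one _ _ h2
      · exact beltDist_le_one _ _ h3
    _ = 3 := by norm_num

theorem beltDist_le_two (hV : ∀ v ∈ V, IsRoot v) (hd : Set.finrank ℝ (V : Set (ι → ℝ)) ≤ 6 ∨
      Set.finrank ℝ (V : Set (ι → ℝ)) = 8 ∧ ∃ σ : ι → Bool,
        ∀ i j, (Pi.single i 1 - Pi.single j 1 : ι → ℝ) ∈ V → σ i ≠ σ j) (P Q : FacetPair V) :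
    beltDist V P Q ≤ 2 := by
  obtain ⟨f, hf, rfl⟩ := P.exists_isNormal
  obtain ⟨g, hg, rfl⟩ := Q.exists_isNormal
  obtain ⟨f', hf', h1, h2⟩ := exists_path_two hV hf hg hd
  calc _ ≤ _ + _ := beltDist_triangle _ (facetPair V (dotL f') hf') _
    _ ≤ 1 + 1 := by
      gcongr
      · exact beltDist_le_one _ _ h1
      · exact beltDist_le_one _ _ h2
    _ = 2 := by norm_num

end UpperBounds

/-! ### Symmetric zonotopes: coloured facets, bipartition, obstruction to a common neighbour -/

section Symmetric

variable {ι : Type*} [Fintype ι] [DecidableEq ι]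

theorem Conjugate.symm {E : Type*} [AddCommGroup E] [Module ℝ E] {d : ℕ} {V₁ V₂ : Finset E}
    (h : Conjugate d V₁ V₂) : Conjugate d V₂ V₁ := by
  obtain ⟨h1, h2, h3, h4, h5, h6, h7⟩ := h
  exact ⟨h2, h1, h4, h3, by rwa [Set.union_comm], h7, h6⟩

/-- A functional that kills `VR` but not some `w ∈ VB` kills no `v ∈ VB`, because `VR` and `v`
together already have full rank `d`. -/
theorem Conjugate.exists_normal [DecidableEq (ι → ℝ)] {d : ℕ} (hd : 3 ≤ d)
    {VR VB : Finset (ι → ℝ)} (h : Conjugate d VR VB) :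
    ∃ f, IsNormal (VR ∪ VB) f ∧ nullSet (VR ∪ VB) (dotL f) = VR := by
  obtain ⟨h1, h2, h3, h4, h5, h6, h7⟩ := h
  obtain ⟨w, hw⟩ : VB.Nonempty := Finset.card_pos.1 (by omega)
  have hwR : w ∉ Submodule.span ℝ (VR : Set (ι → ℝ)) := fun hmem => by
    have h8 := h7 w hw
    rw [Set.finrank, Submodule.span_insert_eq_span hmem] at h8
    unfold Set.finrank at h3
    omega
  obtain ⟨φ, hφw, hφ⟩ := Submodule.exists_le_ker_of_notMem hwR
  obtain ⟨f, hf⟩ := exists_eq_dotL φ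
  have hR : ∀ v ∈ VR, dotL f v = 0 := fun v hv => by
    rw [← hf]; exact hφ (Submodule.subset_span hv)
  rw [hf] at hφw
  have hB : ∀ v ∈ VB, dotL f v ≠ 0 := by
    intro v hv h0
    have h8 : Set.finrank ℝ (insert v (VR : Set (ι → ℝ))) + 1 ≤
        Set.finrank ℝ ((VR : Set (ι → ℝ)) ∪ VB) := by
      refine finrank_lt_of_apply_ne_zero (f := (dotL f).toLinearMap) ?_ ?_ (Or.inr hw) hφw
      · exact Set.insert_subset (Or.inr hv) Set.subset_union_left
      · rintro u (rfl | hu)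
        · exact h0
        · exact hR u hu
    rw [h7 v hv, h5] at h8
    omega
  have hnull : nullSet (VR ∪ VB) (dotL f) = VR := by
    ext v
    rw [mem_nullSet, Finset.mem_union]
    constructor
    · rintro ⟨hv | hv, h0⟩
      · exact hv
      · exact absurd h0 (hB v hv)
    · exact fun hv => ⟨Or.inl hv, hR v hv⟩
  refine ⟨f, ?_, hnull⟩
  rw [IsNormal, hnull, Finset.coe_union, h5, h3]

theorem isRoot_of_mem_permVectors {m : ℕ} {v : Fin (m + 1) → ℝ} (h : v ∈ permVectors m) :
    IsRoot v := by
  obtain ⟨i, j, hij, rfl⟩ := h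
  exact ⟨i, j, hij.ne, rfl⟩

namespace IsSymmetricPi

variable {d m : ℕ} {VR VB : Finset (Fin (m + 1) → ℝ)}

theorem isRoot (h : IsSymmetricPi d m VR VB) : ∀ v ∈ VR ∪ VB, IsRoot v := by
  intro v hv
  rcases Finset.mem_union.1 hv with hv | hv
  · exact isRoot_of_mem_permVectors (h.1 hv)
  · exact isRoot_of_mem_permVectors (h.2.1 hv)

theorem finrank_eq (h : IsSymmetricPi d m VR VB) :
    Set.finrank ℝ ((VR ∪ VB : Finset (Fin (m + 1) → ℝ)) : Set (Fin (m + 1) → ℝ)) = d := by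
  rw [Finset.coe_union]
  exact h.2.2.2.2.2.2.1

theorem exists_normals (hd : 3 ≤ d) (h : IsSymmetricPi d m VR VB) :
    ∃ f g, IsNormal (VR ∪ VB) f ∧ IsNormal (VR ∪ VB) g ∧
      nullSet (VR ∪ VB) (dotL f) = VR ∧ nullSet (VR ∪ VB) (dotL g) = VB := by
  obtain ⟨f, hf, hfR⟩ := h.2.2.exists_normal hd
  obtain ⟨g, hg, hgB⟩ := h.2.2.symm.exists_normal hd
  rw [Finset.union_comm] at hg hgB
  exact ⟨f, g, hf, hg, hfR, hgB⟩

/-- The red and blue vectors form a bipartite graph. -/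
theorem exists_bipartition (hd : 3 ≤ d) (h : IsSymmetricPi d m VR VB) :
    ∃ σ : Fin (m + 1) → Bool,
      ∀ i j, (Pi.single i 1 - Pi.single j 1 : Fin (m + 1) → ℝ) ∈ VR ∪ VB → σ i ≠ σ j := by
  obtain ⟨f, g, hf, hg, hfR, hgB⟩ := h.exists_normals hd
  obtain ⟨a, ha, haf⟩ := exists_indicator h.isRoot hf
  obtain ⟨b, hb, hbg⟩ := exists_indicator h.isRoot hg
  rw [hfR] at haf
  rw [hgB] at hbg
  have hdisj : ∀ v ∈ VR ∪ VB, ¬ (dotL a v = 0 ∧ dotL b v = 0) := by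
    rintro v hv ⟨h1, h2⟩
    have hvR : v ∈ VR := by rw [← haf]; exact mem_nullSet.2 ⟨hv, h1⟩
    have hvB : v ∈ VB := by rw [← hbg]; exact mem_nullSet.2 ⟨hv, h2⟩
    have h3 := h.2.2.2.2.2.2.2.2 v hvB
    rw [Set.insert_eq_of_mem (Finset.mem_coe.2 hvR)] at h3
    have h4 := h.2.2.2.2.1
    omega
  -- Along every zone vector exactly one of the indicators `a`, `b` changes, so the truth of `a i =
  -- b i` flips.
  refine ⟨fun i => decide (a i = b i), fun i j hij heq => ?_⟩
  have hor : dotL a (Pi.single i 1 - Pi.single j 1) = 0 ∨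
      dotL b (Pi.single i 1 - Pi.single j 1) = 0 := by
    rcases Finset.mem_union.1 hij with hv | hv
    · left; rw [← haf] at hv; exact (mem_nullSet.1 hv).2
    · right; rw [← hbg] at hv; exact (mem_nullSet.1 hv).2
  have hnot := hdisj _ hij
  simp only [dotL_single_sub_single, sub_eq_zero] at hor hnot
  rw [decide_eq_decide] at heq
  rcases ha i with h1 | h1 <;> rcases ha j with h2 | h2 <;> rcases hb i with h3 | h3 <;>
  rcases hb j with h4 | h4 <;> simp_all

theorem beltDist_le_three (h : IsSymmetricPi d m VR VB) (P Q : FacetPair (VR ∪ VB)) :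
    beltDist (VR ∪ VB) P Q ≤ 3 :=
  _root_.beltDist_le_three h.isRoot P Q

theorem beltDist_le_two (hd : 3 ≤ d) (hd' : d ≤ 6 ∨ d = 8) (h : IsSymmetricPi d m VR VB)
    (P Q : FacetPair (VR ∪ VB)) : beltDist (VR ∪ VB) P Q ≤ 2 := by
  refine _root_.beltDist_le_two h.isRoot ?_ P Q
  rw [h.finrank_eq]
  exact hd'.imp_right fun h8 => ⟨h8, h.exists_bipartition hd⟩

theorem exists_pairs (hd : 3 ≤ d) (h : IsSymmetricPi d m VR VB) :
    ∃ R B : FacetPair (VR ∪ VB), (∀ P, IsPairWithZones (VR ∪ VB) VR P ↔ P = R) ∧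
      (∀ P, IsPairWithZones (VR ∪ VB) VB P ↔ P = B) := by
  obtain ⟨f, g, hf, hg, hfR, hgB⟩ := h.exists_normals hd
  refine ⟨facetPair _ (dotL f) hf, facetPair _ (dotL g) hg, fun P => ?_, fun P => ?_⟩
  · rw [← isPairWithZones_iff, hfR]
  · rw [← isPairWithZones_iff, hgB]

theorem inter_eq_empty (h : IsSymmetricPi d m VR VB) : VR ∩ VB = ∅ := by
  rw [← Finset.disjoint_iff_inter_eq_empty, Finset.disjoint_left]
  intro v hvR hvB
  have h3 := h.2.2.2.2.2.2.2.2 v hvB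
  rw [Set.insert_eq_of_mem (Finset.mem_coe.2 hvR)] at h3
  have h4 := h.2.2.2.2.1
  omega

/-- The colours have no common vector, so a common belt would force `d ≤ 2`. -/
theorem ne_and_not_adj (hd : 3 ≤ d) (h : IsSymmetricPi d m VR VB) {R B : FacetPair (VR ∪ VB)}
    (hR : IsPairWithZones (VR ∪ VB) VR R) (hB : IsPairWithZones (VR ∪ VB) VB B) :
    R ≠ B ∧ ¬ (venkovGraph (VR ∪ VB)).Adj R B := by
  obtain ⟨f, g, hf, hg, hfR, hgB⟩ := h.exists_normals hd
  have hR' : R = facetPair _ (dotL f) hf := isPairWithZones_iff.1 (by rwa [hfR])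
  have hB' : B = facetPair _ (dotL g) hg := isPairWithZones_iff.1 (by rwa [hgB])
  subst hR' hB'
  have h0 := h.inter_eq_empty
  constructor
  · intro heq
    have h1 := nullSet_eq_of_facetPair_eq heq
    rw [hfR, hgB] at h1
    rw [← h1, Finset.inter_self] at h0
    have h2 := h.2.2.1
    rw [h0, Finset.card_empty] at h2
    omega
  · rw [adj_facetPair_iff]
    rintro ⟨-, h1⟩
    rw [hfR, hgB, h0, Finset.coe_empty, Set.finrank_empty, h.finrank_eq] at h1
    omega

theorem two_le_beltDist (hd : 3 ≤ d) (h : IsSymmetricPi d m VR VB) {R B : FacetPair (VR ∪ VB)}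
    (hR : IsPairWithZones (VR ∪ VB) VR R) (hB : IsPairWithZones (VR ∪ VB) VB B) :
    2 ≤ beltDist (VR ∪ VB) R B := by
  obtain ⟨h1, h2⟩ := h.ne_and_not_adj hd hR hB
  by_contra! hlt
  rw [← one_add_one_eq_two, ENat.lt_add_one_iff (by simp), beltDist,
    SimpleGraph.edist_le_one_iff_adj_or_eq] at hlt
  tauto

/-- A facet adjacent to the red or the blue one contains all but one of its zone vectors. -/
theorem exists_of_adj (h : IsSymmetricPi d m VR VB) {W : Finset (Fin (m + 1) → ℝ)}
    (hW : W.card + 1 = d) {f g : Fin (m + 1) → ℝ}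
    {hf : IsNormal (VR ∪ VB) f} {hg : IsNormal (VR ∪ VB) g}
    (hfR : nullSet (VR ∪ VB) (dotL f) = W)
    (hadj : (venkovGraph (VR ∪ VB)).Adj (facetPair _ (dotL f) hf) (facetPair _ (dotL g) hg)) :
    (∃ v ∈ W, dotL g v ≠ 0) ∧
      ∀ v ∈ W, ∀ w ∈ W, dotL g v ≠ 0 → dotL g w ≠ 0 → v = w := by
  rw [adj_facetPair_iff] at hadj
  obtain ⟨hne, hle⟩ := hadj
  constructor
  · by_contra! hcon
    refine hne (facetPair_eq_of_nullSet_subset fun v hv => ?_)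
    exact mem_nullSet.2 ⟨(mem_nullSet.1 hv).1, hcon v (hfR ▸ hv)⟩
  · intro v hv w hw hgv hgw
    by_contra hvw
    rw [hfR, h.finrank_eq] at hle
    -- `W` has `d - 1` vectors; losing two leaves rank at most `d - 3`, too small for a belt.
    have hsub : W ∩ nullSet (VR ∪ VB) (dotL g) ⊆ (W.erase v).erase w := by
      intro u hu
      obtain ⟨hu, hu'⟩ := Finset.mem_inter.1 hu
      have h0 := (mem_nullSet.1 hu').2
      refine Finset.mem_erase.2 ⟨?_, Finset.mem_erase.2 ⟨?_, hu⟩⟩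
      · rintro rfl; exact hgw h0
      · rintro rfl; exact hgv h0
    have h1 := Finset.card_le_card hsub
    have h2 : Set.finrank ℝ ((W ∩ nullSet (VR ∪ VB) (dotL g) : Finset (Fin (m + 1) → ℝ)) :
        Set (Fin (m + 1) → ℝ)) ≤ _ := finrank_span_finset_le_card _
    have h3 := Finset.card_erase_add_one hv
    have h4 := Finset.card_erase_add_one (Finset.mem_erase.2 ⟨Ne.symm hvw, hw⟩)
    omega

end IsSymmetricPi

/-- If a cut with respect to `h` contains exactly one red and at most one blue vector, then some
coordinate lies on at most one red and at most one blue vector. -/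
theorem exists_coord_of_cut {VR VB : Finset (ι → ℝ)} (hVR : ∀ v ∈ VR, IsRoot v)
    (hVB : ∀ v ∈ VB, IsRoot v) {α : ι → ℝ} (hα : ∀ i, α i = 0 ∨ α i = 1)
    (hαR : ∀ v ∈ VR, dotL α v = 0) (hαB : ∀ v ∈ VB, dotL α v ≠ 0)
    (hconn : ∀ f, (∀ v ∈ VR, dotL f v = 0) → ∃ x y : ℝ, ∀ i, f i = x + y * α i)
    (hblue : ∀ i, ∃ v ∈ VB, v i ≠ 0) {h : ι → ℝ} (hex : ∃ v ∈ VR, dotL h v ≠ 0)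
    (hR : ∀ v ∈ VR, ∀ w ∈ VR, dotL h v ≠ 0 → dotL h w ≠ 0 → v = w)
    (hB : ∀ v ∈ VB, ∀ w ∈ VB, dotL h v ≠ 0 → dotL h w ≠ 0 → v = w) :
    ∃ i, (∀ v ∈ VR, ∀ w ∈ VR, v i ≠ 0 → w i ≠ 0 → v = w) ∧
      ∀ v ∈ VB, ∀ w ∈ VB, v i ≠ 0 → w i ≠ 0 → v = w := by
  have hends : ∀ i j k : ι, (Pi.single i 1 - Pi.single j 1 : ι → ℝ) k ≠ 0 → k = i ∨ k = j := by
    intro i j k hk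
    by_contra! hcon
    simp [hcon.1, hcon.2] at hk
  -- it suffices to find a set with boundary in the cut, on one side of `α`
  have key : ∀ (P : ι → Prop) (x₀ : ι) (t : ℝ), P x₀ → (∀ k, P k → α k = t) →
      (∀ p q, P p → ¬ P q → h p ≠ h q) → ∃ i, (∀ v ∈ VR, ∀ w ∈ VR, v i ≠ 0 → w i ≠ 0 → v = w) ∧
      ∀ v ∈ VB, ∀ w ∈ VB, v i ≠ 0 → w i ≠ 0 → v = w := by
    intro P x₀ t hx₀ hPα hcut
    have hne : ∀ p q, P p → ¬ P q → dotL h (Pi.single p 1 - Pi.single q 1) ≠ 0 ∧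
        dotL h (Pi.single q 1 - Pi.single p 1) ≠ 0 := by
      intro p q hp hq
      have := hcut p q hp hq
      simp only [dotL_single_sub_single, sub_ne_zero]
      exact ⟨this, this.symm⟩
    -- Blue vectors change `α`, which is constant on `P`, so each one at `P` leaves `P` and lies in
    -- the cut.
    have hbl : ∀ x, P x → ∀ v ∈ VB, v x ≠ 0 → dotL h v ≠ 0 ∧ ∀ y, P y → v y ≠ 0 → y = x := by
      intro x hx v hv hvx
      have hαv := hαB v hv
      obtain ⟨i, j, hij, rfl⟩ := hVB v hv
      rw [dotL_single_sub_single, sub_ne_zero] at hαv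
      rcases hends i j x hvx with rfl | rfl
      · have hj : ¬ P j := fun hj => hαv (by rw [hPα _ hx, hPα _ hj])
        refine ⟨(hne x j hx hj).1, fun y hy hvy => ?_⟩
        rcases hends x j y hvy with rfl | rfl
        · rfl
        · exact absurd hy hj
      · have hi : ¬ P i := fun hi => hαv (by rw [hPα _ hx, hPα _ hi])
        refine ⟨(hne x i hx hi).2, fun y hy hvy => ?_⟩
        rcases hends i x y hvy with rfl | rfl
        · exact absurd hy hi
        · rfl
    -- Every coordinate has a blue vector, and the cut contains at most one, which has a single end
    -- in `P`; so `P` is a single coordinate.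
    have huniq : ∀ y, P y → y = x₀ := by
      intro y hy
      obtain ⟨v, hv, hvx⟩ := hblue x₀
      obtain ⟨w, hw, hwy⟩ := hblue y
      have h1 := hbl x₀ hx₀ v hv hvx
      have h2 := hbl y hy w hw hwy
      have hvw := hB v hv w hw h1.1 h2.1
      subst hvw
      exact h1.2 y hy hwy
    have hred : ∀ v ∈ VR, v x₀ ≠ 0 → dotL h v ≠ 0 := by
      intro v hv hvx
      obtain ⟨i, j, hij, rfl⟩ := hVR v hv
      rcases hends i j x₀ hvx with rfl | rfl
      · exact (hne _ j hx₀ fun hj => hij (huniq j hj).symm).1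
      · exact (hne _ i hx₀ fun hi => hij (huniq i hi)).2
    exact ⟨x₀, fun v hv w hw hvx hwx => hR v hv w hw (hred v hv hvx) (hred w hw hwx),
      fun v hv w hw hvx hwx => hB v hv w hw (hbl x₀ hx₀ v hv hvx).1 (hbl x₀ hx₀ w hw hwx).1⟩
  obtain ⟨e, he, hhe⟩ := hex
  obtain ⟨i, j, -, rfl⟩ := hVR e he
  have hαij := hαR _ he
  have hij := hhe
  rw [dotL_single_sub_single, sub_eq_zero] at hαij
  rw [dotL_single_sub_single, sub_ne_zero] at hij
  -- The only red vector along which `h` changes has both ends on the side of `i`, so this function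
  -- kills `VR`. Hence on the other side of `α` the equation `h k = h i` holds everywhere or
  -- nowhere.
  obtain ⟨x, y, hxy⟩ := hconn (fun k => if h k = h i ∧ α k ≠ α i then 1 else 0) (by
    intro v hv
    have hαv := hαR v hv
    by_cases h0 : dotL h v = 0
    · obtain ⟨p, q, -, rfl⟩ := hVR v hv
      rw [dotL_single_sub_single, sub_eq_zero] at h0 hαv
      rw [dotL_single_sub_single]
      simp [h0, hαv]
    · rw [hR v hv _ he h0 hhe, dotL_single_sub_single]
      simp [hαij])
  have hi := hxy i
  simp only [ne_eq, not_true, and_false, if_false] at hi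
  have hother : ∀ k, α k ≠ α i → α k = 1 - α i := by
    intro k hk
    rcases hα k with h1 | h1 <;> rcases hα i with h2 | h2 <;> rw [h1, h2] at hk ⊢
    · exact absurd rfl hk
    · norm_num
    · norm_num
    · exact absurd rfl hk
  -- If it holds everywhere there, take the set `h ≠ h i`, which contains `j`; otherwise the set `h
  -- = h i`. Either lies within the side of `i`.
  by_cases hk : ∃ k, α k ≠ α i ∧ h k = h i
  · obtain ⟨k, hk, hhk⟩ := hk
    refine key (fun k => h k ≠ h i) j (α i) hij.symm (fun l hl => ?_) fun p q hp hq => ?_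
    · by_contra hαl
      have h1 := hxy k
      have h2 := hxy l
      rw [hother k hk, if_pos ⟨hhk, by rw [← hother k hk]; exact hk⟩] at h1
      rw [hother l hαl, if_neg fun h => hl h.1] at h2
      linarith
    · rw [not_not.1 hq]; exact hp
  · push Not at hk
    refine key (fun k => h k = h i) i (α i) rfl (fun l hl => ?_) fun p q hp hq => ?_
    · by_contra hαl
      exact hk l hαl hl
    · rw [hp]; exact Ne.symm hq

end Symmetric

/-! ### Sharp examples from pairs of forests -/

section Examples

/-- The zone vector of the permutahedron joining the coordinates `i` and `j`. -/
noncomputable def edgeVec {d : ℕ} (i j : Fin (d + 1)) : Fin (d + 1) → ℝ :=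
  if i < j then Pi.single i 1 - Pi.single j 1 else Pi.single j 1 - Pi.single i 1

variable {d : ℕ}

theorem edgeVec_mem {i j : Fin (d + 1)} (h : i ≠ j) : edgeVec i j ∈ permVectors d := by
  unfold edgeVec
  split_ifs with hij
  · exact ⟨i, j, hij, rfl⟩
  · exact ⟨j, i, lt_of_le_of_ne (not_lt.1 hij) h.symm, rfl⟩

theorem edgeVec_comm (i j : Fin (d + 1)) : edgeVec i j = edgeVec j i := by
  unfold edgeVec
  rcases lt_trichotomy i j with h | rfl | h
  · rw [if_pos h, if_neg h.not_gt]
  · rfl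
  · rw [if_pos h, if_neg h.not_gt]

theorem dotL_edgeVec_eq_zero {f : Fin (d + 1) → ℝ} {i j : Fin (d + 1)} :
    dotL f (edgeVec i j) = 0 ↔ f i = f j := by
  unfold edgeVec
  split_ifs
  · rw [dotL_single_sub_single, sub_eq_zero]
  · rw [dotL_single_sub_single, sub_eq_zero, eq_comm]

theorem edgeVec_apply_ne_zero {i j : Fin (d + 1)} (h : i ≠ j) (k : Fin (d + 1)) :
    edgeVec i j k ≠ 0 ↔ k = i ∨ k = j := by
  unfold edgeVec
  by_cases hki : k = i
  · subst hki; split_ifs <;> simp [h]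
  · by_cases hkj : k = j
    · subst hkj; split_ifs <;> simp [hki]
    · split_ifs <;> simp [hki, hkj]

/-- The edges of a forest on `Fin (d + 1)` with two roots `r₀`, `r₁` and parent map `p`. -/
noncomputable def forest (d : ℕ) (p : ℕ → ℕ) (r₀ r₁ : ℕ) : Finset (Fin (d + 1) → ℝ) :=
  (((Finset.range (d + 1)).erase r₀).erase r₁).image
    fun v => edgeVec (Fin.ofNat (d + 1) v) (Fin.ofNat (d + 1) (p v))

/-- `p` is the parent map of a forest on `0, …, d` with two roots, whose trees are the classes
of `A`, and whose edges join the two classes of `B`. -/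
structure IsForest (d : ℕ) (p : ℕ → ℕ) (r₀ r₁ : ℕ) (A B : ℕ → Prop) : Prop where
  lt₀ : r₀ < d + 1
  lt₁ : r₁ < d + 1
  ne : r₀ ≠ r₁
  parent : ∀ v < d + 1, v ≠ r₀ → v ≠ r₁ → p v < d + 1 ∧ (A v ↔ A (p v)) ∧ ¬ (B v ↔ B (p v))
  connected : ∀ H : ℕ → ℝ, (∀ v < d + 1, v ≠ r₀ → v ≠ r₁ → H v = H (p v)) →
    ∃ x y : ℝ, ∀ v < d + 1, (A v → H v = x) ∧ (¬ A v → H v = y)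

/-- The vertices `v` and `w` are joined by an edge of the forest with parent map `p`. -/
def ForestAdj (d : ℕ) (p : ℕ → ℕ) (r₀ r₁ v w : ℕ) : Prop :=
  w < d + 1 ∧ ((v ≠ r₀ ∧ v ≠ r₁ ∧ p v = w) ∨ (w ≠ r₀ ∧ w ≠ r₁ ∧ p w = v))

open scoped Classical in
/-- The indicator of `A` on `Fin (d + 1)`. -/
noncomputable def finInd (d : ℕ) (A : ℕ → Prop) : Fin (d + 1) → ℝ := fun i => if A i then 1 else 0

theorem val_ofNat_of_lt {v : ℕ} (hv : v < d + 1) : (Fin.ofNat (d + 1) v : ℕ) = v :=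
  Nat.mod_eq_of_lt hv

theorem ofNat_val (i : Fin (d + 1)) : Fin.ofNat (d + 1) i = i :=
  Fin.ext (Nat.mod_eq_of_lt i.isLt)

theorem ofNat_ne_ofNat {v w : ℕ} (hv : v < d + 1) (hw : w < d + 1) (h : v ≠ w) :
    (Fin.ofNat (d + 1) v) ≠ (Fin.ofNat (d + 1) w) := by
  intro h'
  have := congrArg Fin.val h'
  rw [val_ofNat_of_lt hv, val_ofNat_of_lt hw] at this
  exact h this

namespace IsForest

variable {p : ℕ → ℕ} {r₀ r₁ : ℕ} {A B : ℕ → Prop} (h : IsForest d p r₀ r₁ A B)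
include h

theorem parent_ne {v : ℕ} (hv : v < d + 1) (h₀ : v ≠ r₀) (h₁ : v ≠ r₁) : v ≠ p v := fun he =>
  (h.parent v hv h₀ h₁).2.2 (by rw [← he])

theorem exists_of_mem {w : Fin (d + 1) → ℝ} (hw : w ∈ forest d p r₀ r₁) :
    ∃ v, v < d + 1 ∧ v ≠ r₀ ∧ v ≠ r₁ ∧
      w = edgeVec (Fin.ofNat (d + 1) v) (Fin.ofNat (d + 1) (p v)) := by
  obtain ⟨v, hv, rfl⟩ := Finset.mem_image.1 hw
  simp only [Finset.mem_erase, Finset.mem_range] at hv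
  exact ⟨v, hv.2.2, hv.2.1, hv.1, rfl⟩

theorem mem_forest {v : ℕ} (hv : v < d + 1) (h₀ : v ≠ r₀) (h₁ : v ≠ r₁) :
    edgeVec (Fin.ofNat (d + 1) v) (Fin.ofNat (d + 1) (p v)) ∈ forest d p r₀ r₁ :=
  Finset.mem_image.2 ⟨v, by simp only [Finset.mem_erase, Finset.mem_range]; tauto, rfl⟩

theorem subset_permVectors : (forest d p r₀ r₁ : Set (Fin (d + 1) → ℝ)) ⊆ permVectors d := by
  intro w hw
  obtain ⟨v, hv, h₀, h₁, rfl⟩ := h.exists_of_mem hw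
  exact edgeVec_mem (ofNat_ne_ofNat hv (h.parent v hv h₀ h₁).1 (h.parent_ne hv h₀ h₁))

theorem card_le : (forest d p r₀ r₁).card + 1 ≤ d := by
  have h1 := Finset.card_erase_add_one (Finset.mem_range.2 h.lt₀)
  have h2 := Finset.card_erase_add_one
    (Finset.mem_erase.2 ⟨h.ne.symm, Finset.mem_range.2 h.lt₁⟩)
  have h3 : (forest d p r₀ r₁).card ≤ _ := Finset.card_image_le
  rw [Finset.card_range] at h1
  omega

theorem dotL_left {w : Fin (d + 1) → ℝ} (hw : w ∈ forest d p r₀ r₁) :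
    dotL (finInd d A) w = 0 := by
  obtain ⟨v, hv, h₀, h₁, rfl⟩ := h.exists_of_mem hw
  obtain ⟨h1, h2, -⟩ := h.parent v hv h₀ h₁
  rw [dotL_edgeVec_eq_zero, finInd, val_ofNat_of_lt hv, finInd, val_ofNat_of_lt h1]
  by_cases hA : A v
  · rw [if_pos hA, if_pos (h2.1 hA)]
  · rw [if_neg hA, if_neg fun h => hA (h2.2 h)]

theorem dotL_right {w : Fin (d + 1) → ℝ} (hw : w ∈ forest d p r₀ r₁) :
    dotL (finInd d B) w ≠ 0 := by
  obtain ⟨v, hv, h₀, h₁, rfl⟩ := h.exists_of_mem hw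
  obtain ⟨h1, -, h2⟩ := h.parent v hv h₀ h₁
  rw [ne_eq, dotL_edgeVec_eq_zero, finInd, val_ofNat_of_lt hv, finInd, val_ofNat_of_lt h1]
  by_cases hB : B v <;> by_cases hB' : B (p v) <;> simp_all

theorem exists_eq_add_mul {f : Fin (d + 1) → ℝ} (hf : ∀ w ∈ forest d p r₀ r₁, dotL f w = 0) :
    ∃ x y : ℝ, ∀ i, f i = x + y * finInd d A i := by
  obtain ⟨x, y, hxy⟩ := h.connected (fun v => f (Fin.ofNat (d + 1) v)) fun v hv h₀ h₁ =>
    dotL_edgeVec_eq_zero.1 (hf _ (h.mem_forest hv h₀ h₁))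
  refine ⟨y, x - y, fun i => ?_⟩
  have hi := hxy i i.isLt
  rw [ofNat_val] at hi
  unfold finInd
  split_ifs with hA
  · rw [hi.1 hA]; ring
  · rw [hi.2 hA]; ring

/-- A functional killing all edges is constant on each of the two trees, so the annihilator is
spanned by two functionals. -/
theorem le_finrank : d ≤ Set.finrank ℝ (forest d p r₀ r₁ : Set (Fin (d + 1) → ℝ)) + 1 := by
  have h1 : Set.finrank ℝ (Set.univ : Set (Fin (d + 1) → ℝ)) ≤
      Set.finrank ℝ (forest d p r₀ r₁ : Set (Fin (d + 1) → ℝ)) + 2 := by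
    refine finrank_le_add_two (f := (dotL 1).toLinearMap) (g := (dotL (finInd d A)).toLinearMap)
      fun φ hφ => ?_
    obtain ⟨f, hf⟩ := exists_eq_dotL φ
    obtain ⟨x, y, hxy⟩ := h.exists_eq_add_mul (f := f) fun w hw => by rw [← hf]; exact hφ w hw
    refine ⟨x, y, fun v _ => ?_⟩
    rw [hf]
    have : f = x • 1 + y • finInd d A := by ext i; simp [hxy i]
    rw [this, dotL_add, dotL_smul, dotL_smul]
    rfl
  rw [Set.finrank, Submodule.span_univ, finrank_top, Module.finrank_fin_fun] at h1
  omega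

theorem mem_of_forestAdj {v w : ℕ} (hv : v < d + 1) (hvw : ForestAdj d p r₀ r₁ v w) :
    v ≠ w ∧ edgeVec (Fin.ofNat (d + 1) v) (Fin.ofNat (d + 1) w) ∈ forest d p r₀ r₁ := by
  obtain ⟨hw, ⟨h₀, h₁, rfl⟩ | ⟨h₀, h₁, rfl⟩⟩ := hvw
  · exact ⟨h.parent_ne hv h₀ h₁, h.mem_forest hv h₀ h₁⟩
  · rw [edgeVec_comm]
    exact ⟨(h.parent_ne hw h₀ h₁).symm, h.mem_forest hw h₀ h₁⟩

theorem not_unique_of_forestAdj {v w w' : ℕ} (hv : v < d + 1) (hne : w ≠ w')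
    (hw : ForestAdj d p r₀ r₁ v w) (hw' : ForestAdj d p r₀ r₁ v w') :
    ¬ ∀ e ∈ forest d p r₀ r₁, ∀ e' ∈ forest d p r₀ r₁,
      e (Fin.ofNat (d + 1) v) ≠ 0 → e' (Fin.ofNat (d + 1) v) ≠ 0 → e = e' := by
  intro huniq
  obtain ⟨h1, h2⟩ := h.mem_of_forestAdj hv hw
  obtain ⟨h3, h4⟩ := h.mem_of_forestAdj hv hw'
  have h1' := ofNat_ne_ofNat hv hw.1 h1
  have h3' := ofNat_ne_ofNat hv hw'.1 h3
  have heq := huniq _ h2 _ h4 ((edgeVec_apply_ne_zero h1' _).2 (Or.inl rfl))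
    ((edgeVec_apply_ne_zero h3' _).2 (Or.inl rfl))
  have h5 := (edgeVec_apply_ne_zero h1' (Fin.ofNat (d + 1) w)).2 (Or.inr rfl)
  rw [heq, edgeVec_apply_ne_zero h3'] at h5
  rcases h5 with h5 | h5
  · exact h1' h5.symm
  · exact ofNat_ne_ofNat hw.1 hw'.1 hne h5

end IsForest

variable {p : ℕ → ℕ} {r₀ r₁ : ℕ} {q : ℕ → ℕ} {s₀ s₁ : ℕ} {A B : ℕ → Prop}

/-- Each forest has `d - 1` independent edges, and an edge of one joins the two trees of the other,
raising its rank to `d`. No more is possible, as all vectors have coordinate sum zero. -/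
theorem isSymmetricPi_forest (hd : 3 ≤ d) (hp : IsForest d p r₀ r₁ A B)
    (hq : IsForest d q s₀ s₁ B A) :
    IsSymmetricPi d d (forest d p r₀ r₁) (forest d q s₀ s₁) := by
  set VR := forest d p r₀ r₁ with hVR
  set VB := forest d q s₀ s₁ with hVB
  have hR1 : VR.card + 1 ≤ d := hp.card_le
  have hR2 : d ≤ Set.finrank ℝ (VR : Set (Fin (d + 1) → ℝ)) + 1 := hp.le_finrank
  have hB1 : VB.card + 1 ≤ d := hq.card_le
  have hB2 : d ≤ Set.finrank ℝ (VB : Set (Fin (d + 1) → ℝ)) + 1 := hq.le_finrank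
  have hR3 : Set.finrank ℝ (VR : Set (Fin (d + 1) → ℝ)) ≤ VR.card := finrank_span_finset_le_card VR
  have hB3 : Set.finrank ℝ (VB : Set (Fin (d + 1) → ℝ)) ≤ VB.card := finrank_span_finset_le_card VB
  have hsum : Set.finrank ℝ ((VR : Set (Fin (d + 1) → ℝ)) ∪ VB) ≤ d := by
    have h1 : Set.finrank ℝ ((VR : Set (Fin (d + 1) → ℝ)) ∪ VB) + 1 ≤
        Set.finrank ℝ (Set.univ : Set (Fin (d + 1) → ℝ)) := by
      refine finrank_lt_of_apply_ne_zero (f := (dotL 1).toLinearMap) (Set.subset_univ _) ?_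
        (Set.mem_univ (Pi.single 0 1)) ?_
      · intro v hv
        have hv' : v ∈ permVectors d := by
          rcases hv with hv | hv
          · exact hp.subset_permVectors hv
          · exact hq.subset_permVectors hv
        obtain ⟨i, j, -, rfl⟩ := hv'
        simp
      · simp [dotL_apply]
    rw [Set.finrank, Set.finrank, Submodule.span_univ, finrank_top, Module.finrank_fin_fun] at h1
    rw [Set.finrank]
    omega
  have hRi : ∀ e ∈ VB, d ≤ Set.finrank ℝ (insert e (VR : Set (Fin (d + 1) → ℝ))) := by
    intro e he
    have := finrank_lt_of_apply_ne_zero (f := (dotL (finInd d A)).toLinearMap)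
      (Set.subset_insert e (VR : Set (Fin (d + 1) → ℝ))) (fun v hv => hp.dotL_left hv)
      (Set.mem_insert _ _) (hq.dotL_right he)
    omega
  have hBi : ∀ e ∈ VR, d ≤ Set.finrank ℝ (insert e (VB : Set (Fin (d + 1) → ℝ))) := by
    intro e he
    have := finrank_lt_of_apply_ne_zero (f := (dotL (finInd d B)).toLinearMap)
      (Set.subset_insert e (VB : Set (Fin (d + 1) → ℝ))) (fun v hv => hq.dotL_left hv)
      (Set.mem_insert _ _) (hp.dotL_right he)
    omega
  have hRs : ∀ e ∈ VB, Set.finrank ℝ (insert e (VR : Set (Fin (d + 1) → ℝ))) ≤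
      Set.finrank ℝ ((VR : Set (Fin (d + 1) → ℝ)) ∪ VB) := fun e he =>
    finrank_mono_set (Set.insert_subset (Or.inr he) Set.subset_union_left)
  have hBs : ∀ e ∈ VR, Set.finrank ℝ (insert e (VB : Set (Fin (d + 1) → ℝ))) ≤
      Set.finrank ℝ ((VR : Set (Fin (d + 1) → ℝ)) ∪ VB) := fun e he =>
    finrank_mono_set (Set.insert_subset (Or.inl he) Set.subset_union_right)
  obtain ⟨w, hw⟩ : VB.Nonempty := Finset.card_pos.1 (by omega)
  refine ⟨hp.subset_permVectors, hq.subset_permVectors, by omega, by omega, by omega, by omega,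
    hsum.antisymm ((hRi w hw).trans (hRs w hw)), fun e he => ?_, fun e he => ?_⟩
  · exact ((hBs e he).trans hsum).antisymm (hBi e he)
  · exact ((hRs e he).trans hsum).antisymm (hRi e he)

/-- If every vertex has neighbours of both colours, and two neighbours of one colour, then the belt
distance between the red and the blue facets exceeds two. -/
theorem two_lt_beltDist_forest (hd : 3 ≤ d) (hp : IsForest d p r₀ r₁ A B)
    (hq : IsForest d q s₀ s₁ B A)
    (hdeg : ∀ v < d + 1, (∃ w, ForestAdj d q s₀ s₁ v w) ∧
      ((∃ w w', w ≠ w' ∧ ForestAdj d p r₀ r₁ v w ∧ ForestAdj d p r₀ r₁ v w') ∨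
        ∃ w w', w ≠ w' ∧ ForestAdj d q s₀ s₁ v w ∧ ForestAdj d q s₀ s₁ v w'))
    {R B : FacetPair (forest d p r₀ r₁ ∪ forest d q s₀ s₁)}
    (hR : IsPairWithZones _ (forest d p r₀ r₁) R) (hB : IsPairWithZones _ (forest d q s₀ s₁) B) :
    2 < beltDist _ R B := by
  have h := isSymmetricPi_forest hd hp hq
  rw [beltDist, SimpleGraph.two_lt_edist_iff]
  obtain ⟨h1, h2⟩ := h.ne_and_not_adj hd hR hB
  refine ⟨h1, h2, Set.eq_empty_iff_forall_notMem.2 fun H hH => ?_⟩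
  obtain ⟨hRH, hBH⟩ := (SimpleGraph.mem_commonNeighbors _).1 hH
  obtain ⟨f, g, hf, hg, hfR, hgB⟩ := h.exists_normals hd
  have hR' : R = facetPair _ (dotL f) hf := isPairWithZones_iff.1 (by rwa [hfR])
  have hB' : B = facetPair _ (dotL g) hg := isPairWithZones_iff.1 (by rwa [hgB])
  obtain ⟨l, hl, rfl⟩ := H.exists_isNormal
  subst hR' hB'
  -- The normal of a common neighbour defines a cut with exactly one red and at most one blue
  -- vector; the vertex it produces contradicts `hdeg`.
  obtain ⟨h3, h4⟩ := h.exists_of_adj h.2.2.1 hfR hRH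
  have h5 := (h.exists_of_adj h.2.2.2.1 hgB hBH).2
  obtain ⟨i, hiR, hiB⟩ := exists_coord_of_cut
    (fun v hv => isRoot_of_mem_permVectors (hp.subset_permVectors hv))
    (fun v hv => isRoot_of_mem_permVectors (hq.subset_permVectors hv))
    (α := finInd d A) (fun i => by unfold finInd; split_ifs <;> simp)
    (fun v hv => hp.dotL_left hv) (fun v hv => hq.dotL_right hv)
    (fun f hf => hp.exists_eq_add_mul hf) (fun i => by
      obtain ⟨⟨w, hw⟩, -⟩ := hdeg i i.isLt
      obtain ⟨hne, hmem⟩ := hq.mem_of_forestAdj i.isLt hw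
      refine ⟨_, hmem, (edgeVec_apply_ne_zero (ofNat_ne_ofNat i.isLt hw.1 hne) i).2 ?_⟩
      rw [ofNat_val]
      exact Or.inl rfl) h3 h4 h5
  rcases (hdeg i i.isLt).2 with ⟨w, w', hne, hw, hw'⟩ | ⟨w, w', hne, hw, hw'⟩
  · apply hp.not_unique_of_forestAdj i.isLt hne hw hw'
    rw [ofNat_val]
    exact hiR
  · apply hq.not_unique_of_forestAdj i.isLt hne hw hw'
    rw [ofNat_val]
    exact hiB

/-- Two stars with common leaves. -/
theorem exists_isSymmetricPi (hd : 3 ≤ d) :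
    ∃ VR VB : Finset (Fin (d + 1) → ℝ), IsSymmetricPi d d VR VB := by
  -- The red star is centred at 0 with 1 isolated, the blue star at 1 with 0 isolated.
  refine ⟨_, _, isSymmetricPi_forest (p := fun _ => 0) (q := fun _ => 1) (r₀ := 0) (r₁ := 1)
    (s₀ := 0) (s₁ := 1) (A := fun v => v = 1) (B := fun v => v = 0) hd ?_ ?_⟩
  · refine ⟨by omega, by omega, by omega, fun v hv h0 h1 => by simp; omega, fun H hH => ?_⟩
    refine ⟨H 1, H 0, fun v hv => ⟨fun h => by rw [h], fun h => ?_⟩⟩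
    by_cases h0 : v = 0
    · rw [h0]
    · exact hH v hv h0 h
  · refine ⟨by omega, by omega, by omega, fun v hv h0 h1 => by simp; omega, fun H hH => ?_⟩
    refine ⟨H 0, H 1, fun v hv => ⟨fun h => by rw [h], fun h => ?_⟩⟩
    by_cases h1 : v = 1
    · rw [h1]
    · exact hH v hv h h1

/-- Red parents: a long path from `6` to `N - 1` with a pendant path `6 - 3 - 2`, and a small tree
on `0, 1, 4, 5` and possibly `N`. -/
def redParent (d N : ℕ) (v : ℕ) : ℕ :=
  if v = 1 then 0 else if v = 2 then 3 else if v = 3 then 6 else if v = 4 then 5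
  else if v = 5 then (if d + 1 = N then 0 else N) else if v = N then 1 else v - 1

/-- Blue parents: two stars with centres `0` and `1`, extended by pendant paths. -/
def blueParent (N : ℕ) (v : ℕ) : ℕ :=
  if v = 2 then 1 else if v = 3 then 4 else if v = 4 then N - 1 else if v = 5 then 2
  else if v = N then N - 1 else if v % 2 = 0 then 1 else 0

/-- The vertices of the red tree containing the long path. -/
def redSide (N : ℕ) (v : ℕ) : Prop := v = 2 ∨ v = 3 ∨ (6 ≤ v ∧ v < N)

/-- The vertices of the blue tree containing `0`. -/
def blueSide (N : ℕ) (v : ℕ) : Prop :=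
  v = 0 ∨ v = 3 ∨ v = 4 ∨ v = N ∨ (6 ≤ v ∧ v < N ∧ v % 2 = 1)

variable {N : ℕ} (hN : N % 2 = 0) (hdN : d + 1 = N ∧ 8 ≤ N ∨ d = N ∧ 10 ≤ N)
include hN hdN

theorem isForest_redParent : IsForest d (redParent d N) 0 6 (redSide N) (blueSide N) := by
  refine ⟨by omega, by omega, by omega, fun v hv h0 h1 => ?_, fun H hH => ?_⟩
  · generalize hw : redParent d N v = w
    unfold redSide blueSide
    unfold redParent at hw
    split_ifs at hw <;> refine ⟨by omega, ⟨fun h => by omega, fun h => by omega⟩, ?_⟩ <;>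
      rw [not_iff] <;> exact ⟨fun h => by omega, fun h => by omega⟩
  · have h1 : H 1 = H 0 := hH 1 (by omega) (by omega) (by omega)
    have h3 : H 3 = H 6 := hH 3 (by omega) (by omega) (by omega)
    have h2 : H 2 = H 3 := hH 2 (by omega) (by omega) (by omega)
    have h4 : H 4 = H 5 := hH 4 (by omega) (by omega) (by omega)
    have hN' : d = N → H N = H 1 := fun h => by
      rw [hH N (by omega) (by omega) (by omega)]
      congr 1
      unfold redParent
      split_ifs <;> omega
    have h5 : H 5 = H 0 := by
      rw [hH 5 (by omega) (by omega) (by omega)]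
      change H (if d + 1 = N then 0 else N) = _
      split_ifs with h
      · rfl
      · rw [hN' (by omega), h1]
    have hpath : ∀ k, 6 + k < N → H (6 + k) = H 6 := by
      intro k
      induction k with
      | zero => intro _; rfl
      | succ k ih =>
        intro hk
        rw [hH (6 + (k + 1)) (by omega) (by omega) (by omega), ← ih (by omega)]
        congr 1
        unfold redParent
        split_ifs <;> omega
    refine ⟨H 6, H 0, fun v hv => ⟨fun h => ?_, fun h => ?_⟩⟩
    · rcases h with rfl | rfl | ⟨h6, h⟩
      · rw [h2, h3]
      · exact h3
      · obtain ⟨k, rfl⟩ := Nat.exists_eq_add_of_le h6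
        exact hpath k h
    · unfold redSide at h
      have hv' : v = 0 ∨ v = 1 ∨ v = 4 ∨ v = 5 ∨ v = N ∧ d = N := by omega
      rcases hv' with rfl | rfl | rfl | rfl | ⟨rfl, h⟩
      · rfl
      · exact h1
      · rw [h4, h5]
      · exact h5
      · rw [hN' h, h1]

theorem isForest_blueParent : IsForest d (blueParent N) 0 1 (blueSide N) (redSide N) := by
  refine ⟨by omega, by omega, by omega, fun v hv h0 h1 => ?_, fun H hH => ?_⟩
  · generalize hw : blueParent N v = w
    unfold redSide blueSide
    unfold blueParent at hw
    split_ifs at hw <;> refine ⟨by omega, ⟨fun h => by omega, fun h => by omega⟩, ?_⟩ <;>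
      rw [not_iff] <;> exact ⟨fun h => by omega, fun h => by omega⟩
  · have hpath : ∀ v, 6 ≤ v → v < N → H v = H (if v % 2 = 0 then 1 else 0) := by
      intro v hv hvN
      rw [hH v (by omega) (by omega) (by omega)]
      congr 1
      unfold blueParent
      split_ifs <;> omega
    have hlast : H (N - 1) = H 0 := by
      rw [hpath (N - 1) (by omega) (by omega), if_neg (by omega)]
    have h2 : H 2 = H 1 := hH 2 (by omega) (by omega) (by omega)
    have h3 : H 3 = H 4 := hH 3 (by omega) (by omega) (by omega)
    have h4 : H 4 = H (N - 1) := hH 4 (by omega) (by omega) (by omega)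
    have h5 : H 5 = H 2 := hH 5 (by omega) (by omega) (by omega)
    have hN' : d = N → H N = H (N - 1) := fun h => by
      rw [hH N (by omega) (by omega) (by omega)]
      congr 1
      unfold blueParent
      split_ifs <;> omega
    refine ⟨H 0, H 1, fun v hv => ⟨fun h => ?_, fun h => ?_⟩⟩
    · rcases h with rfl | rfl | rfl | rfl | ⟨h6, h, hodd⟩
      · rfl
      · rw [h3, h4, hlast]
      · rw [h4, hlast]
      · rw [hN' (by omega), hlast]
      · rw [hpath v h6 h, if_neg (by omega)]
    · unfold blueSide at h
      have hv' : v = 1 ∨ v = 2 ∨ v = 5 ∨ 6 ≤ v ∧ v < N ∧ v % 2 = 0 := by omega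
      rcases hv' with rfl | rfl | rfl | ⟨h6, h, heven⟩
      · rfl
      · exact h2
      · rw [h5, h2]
      · rw [hpath v h6 h, if_pos heven]

/-- This is the degree condition of `two_lt_beltDist_forest`. As `N` is even, `N - 1` is odd and
thus a blue neighbour of 0. Inner vertices of the long red path have two red neighbours; the
remaining vertices are checked one by one. -/
theorem forestAdj_parents : ∀ v < d + 1, (∃ w, ForestAdj d (blueParent N) 0 1 v w) ∧
    ((∃ w w', w ≠ w' ∧ ForestAdj d (redParent d N) 0 6 v w ∧
        ForestAdj d (redParent d N) 0 6 v w') ∨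
      ∃ w w', w ≠ w' ∧ ForestAdj d (blueParent N) 0 1 v w ∧
        ForestAdj d (blueParent N) 0 1 v w') := by
  have red : ∀ v w, w < d + 1 → (v ≠ 0 ∧ v ≠ 6 ∧ redParent d N v = w) ∨
      (w ≠ 0 ∧ w ≠ 6 ∧ redParent d N w = v) → ForestAdj d (redParent d N) 0 6 v w :=
    fun v w h1 h2 => ⟨h1, h2⟩
  have blue : ∀ v w, w < d + 1 → (v ≠ 0 ∧ v ≠ 1 ∧ blueParent N v = w) ∨
      (w ≠ 0 ∧ w ≠ 1 ∧ blueParent N w = v) → ForestAdj d (blueParent N) 0 1 v w :=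
    fun v w h1 h2 => ⟨h1, h2⟩
  have b7 : blueParent N 7 = 0 := by unfold blueParent; split_ifs <;> omega
  have r7 : redParent d N 7 = 6 := by unfold redParent; split_ifs <;> omega
  have bN : blueParent N (N - 1) = 0 := by unfold blueParent; split_ifs <;> omega
  have rmid : ∀ v, 7 ≤ v → v < N → redParent d N v = v - 1 := fun v h1 h2 => by
    unfold redParent; split_ifs <;> omega
  intro v hv
  have hv' : v = 0 ∨ v = 1 ∨ v = 2 ∨ v = 3 ∨ v = 4 ∨ v = 5 ∨ v = 6 ∨ (7 ≤ v ∧ v < N - 1) ∨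
      (v = N - 1) ∨ v = N ∧ d = N := by omega
  rcases hv' with rfl | rfl | rfl | rfl | rfl | rfl | rfl | ⟨h7, hvN⟩ | rfl | ⟨rfl, hdv⟩
  · refine ⟨⟨7, blue _ _ (by omega) (Or.inr ⟨by omega, by omega, b7⟩)⟩, ?_⟩
    rcases hdN with ⟨h, h8⟩ | ⟨h, h10⟩
    · refine Or.inl ⟨1, 5, by omega, red _ _ (by omega) (Or.inr ⟨by omega, by omega, rfl⟩),
        red _ _ (by omega) (Or.inr ⟨by omega, by omega, ?_⟩)⟩
      change (if d + 1 = N then 0 else N) = 0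
      rw [if_pos h]
    -- With the extra vertex `N` the small red tree is the path `0 - 1 - N - 5 - 4`, so 0 has one
    -- red neighbour and needs two blue ones, 7 and 9; this is where `N ≥ 10` enters.
    · refine Or.inr ⟨7, 9, by omega, blue _ _ (by omega) (Or.inr ⟨by omega, by omega, b7⟩),
        blue _ _ (by omega) (Or.inr ⟨by omega, by omega, ?_⟩)⟩
      unfold blueParent
      split_ifs <;> omega
  · have h6 : ForestAdj d (blueParent N) 0 1 1 6 :=
      blue _ _ (by omega) (Or.inr ⟨by omega, by omega, by unfold blueParent; split_ifs <;> omega⟩)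
    exact ⟨⟨6, h6⟩, Or.inr ⟨6, 2, by omega, h6,
      blue _ _ (by omega) (Or.inr ⟨by omega, by omega, rfl⟩)⟩⟩
  · have h1 : ForestAdj d (blueParent N) 0 1 2 1 :=
      blue _ _ (by omega) (Or.inl ⟨by omega, by omega, rfl⟩)
    exact ⟨⟨1, h1⟩, Or.inr ⟨1, 5, by omega, h1,
      blue _ _ (by omega) (Or.inr ⟨by omega, by omega, rfl⟩)⟩⟩
  · exact ⟨⟨4, blue _ _ (by omega) (Or.inl ⟨by omega, by omega, rfl⟩)⟩,
      Or.inl ⟨6, 2, by omega, red _ _ (by omega) (Or.inl ⟨by omega, by omega, rfl⟩),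
        red _ _ (by omega) (Or.inr ⟨by omega, by omega, rfl⟩)⟩⟩
  · have h3 : ForestAdj d (blueParent N) 0 1 4 3 :=
      blue _ _ (by omega) (Or.inr ⟨by omega, by omega, rfl⟩)
    exact ⟨⟨3, h3⟩, Or.inr ⟨3, N - 1, by omega, h3,
      blue _ _ (by omega) (Or.inl ⟨by omega, by omega, rfl⟩)⟩⟩
  · refine ⟨⟨2, blue _ _ (by omega) (Or.inl ⟨by omega, by omega, rfl⟩)⟩,
      Or.inl ⟨4, if d + 1 = N then 0 else N, by split_ifs <;> omega,
        red _ _ (by omega) (Or.inr ⟨by omega, by omega, rfl⟩),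
        red _ _ (by split_ifs <;> omega) (Or.inl ⟨by omega, by omega, rfl⟩)⟩⟩
  · refine ⟨⟨1, blue _ _ (by omega) (Or.inl ⟨by omega, by omega, ?_⟩)⟩,
      Or.inl ⟨7, 3, by omega, red _ _ (by omega) (Or.inr ⟨by omega, by omega, r7⟩),
        red _ _ (by omega) (Or.inr ⟨by omega, by omega, rfl⟩)⟩⟩
    unfold blueParent
    split_ifs <;> omega
  · refine ⟨⟨blueParent N v, blue _ _ ?_ (Or.inl ⟨by omega, by omega, rfl⟩)⟩,
      Or.inl ⟨v - 1, v + 1, by omega,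
        red _ _ (by omega) (Or.inl ⟨by omega, by omega, rmid v h7 (by omega)⟩),
        red _ _ (by omega) (Or.inr ⟨by omega, by omega, ?_⟩)⟩⟩
    · unfold blueParent
      split_ifs <;> omega
    · rw [rmid (v + 1) (by omega) (by omega)]
      omega
  · have h0 : ForestAdj d (blueParent N) 0 1 (N - 1) 0 :=
      blue _ _ (by omega) (Or.inl ⟨by omega, by omega, bN⟩)
    exact ⟨⟨0, h0⟩, Or.inr ⟨0, 4, by omega, h0,
      blue _ _ (by omega) (Or.inr ⟨by omega, by omega, rfl⟩)⟩⟩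
  · refine ⟨⟨v - 1, blue _ _ (by omega) (Or.inl ⟨by omega, by omega, ?_⟩)⟩,
      Or.inl ⟨1, 5, by omega, red _ _ (by omega) (Or.inl ⟨by omega, by omega, ?_⟩),
        red _ _ (by omega) (Or.inr ⟨by omega, by omega, ?_⟩)⟩⟩
    · unfold blueParent
      split_ifs <;> omega
    · unfold redParent
      split_ifs <;> omega
    · unfold redParent
      split_ifs <;> omega

end Examples

/-! ### Assembling the theorem -/

theorem exists_isSymmetricPi_of_large {d : ℕ} (hd : d = 7 ∨ 9 ≤ d) :
    ∃ VR VB : Finset (Fin (d + 1) → ℝ), IsSymmetricPi d d VR VB ∧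
      ∀ R B : FacetPair (VR ∪ VB), IsPairWithZones _ VR R → IsPairWithZones _ VB B →
        2 < beltDist _ R B := by
  -- `N` is the even one of `d` and `d + 1`.
  obtain ⟨N, hN, hdN⟩ : ∃ N, N % 2 = 0 ∧ (d + 1 = N ∧ 8 ≤ N ∨ d = N ∧ 10 ≤ N) := by
    by_cases hodd : d % 2 = 1
    · exact ⟨d + 1, by omega, by omega⟩
    · exact ⟨d, by omega, by omega⟩
  have hp := isForest_redParent hN hdN
  have hq := isForest_blueParent hN hdN
  exact ⟨_, _, isSymmetricPi_forest (by omega) hp hq, fun R B hR hB =>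
    two_lt_beltDist_forest (by omega) hp hq (forestAdj_parents hN hdN) hR hB⟩

theorem mainTheorem2 (d : ℕ) (hd : 3 ≤ d) :
    -- every symmetric zonotope has one red and one blue pair of facets, and the bounds hold
    (∀ (m : ℕ) (VR VB : Finset (Fin (m + 1) → ℝ)), IsSymmetricPi d m VR VB →
      ∃ R B : FacetPair (VR ∪ VB),
        (∀ P, IsPairWithZones (VR ∪ VB) VR P ↔ P = R) ∧
        (∀ P, IsPairWithZones (VR ∪ VB) VB P ↔ P = B) ∧
        (d ≤ 6 ∨ d = 8 → beltDist (VR ∪ VB) R B ≤ 2) ∧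
        (d = 7 ∨ 9 ≤ d → beltDist (VR ∪ VB) R B ≤ 3)) ∧
    -- the bounds are attained, already in `ℝ^(d+1)`
    (∃ (VR VB : Finset (Fin (d + 1) → ℝ)) (R B : FacetPair (VR ∪ VB)),
      IsSymmetricPi d d VR VB ∧
      IsPairWithZones (VR ∪ VB) VR R ∧ IsPairWithZones (VR ∪ VB) VB B ∧
      (d ≤ 6 ∨ d = 8 → beltDist (VR ∪ VB) R B = 2) ∧
      (d = 7 ∨ 9 ≤ d → beltDist (VR ∪ VB) R B = 3)) ∧
    -- the maximal belt diameter
    (d ≤ 6 ∨ d = 8 → xiPi d = 2) ∧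
    (d = 7 ∨ 9 ≤ d → xiPi d = 3) := by
  have hsharp : ∃ (VR VB : Finset (Fin (d + 1) → ℝ)) (R B : FacetPair (VR ∪ VB)),
      IsSymmetricPi d d VR VB ∧
      IsPairWithZones (VR ∪ VB) VR R ∧ IsPairWithZones (VR ∪ VB) VB B ∧
      (d ≤ 6 ∨ d = 8 → beltDist (VR ∪ VB) R B = 2) ∧
      (d = 7 ∨ 9 ≤ d → beltDist (VR ∪ VB) R B = 3) := by
    by_cases hsmall : d ≤ 6 ∨ d = 8
    · obtain ⟨VR, VB, h⟩ := exists_isSymmetricPi hd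
      obtain ⟨R, B, hR, hB⟩ := h.exists_pairs hd
      have hR' := (hR R).2 rfl
      have hB' := (hB B).2 rfl
      exact ⟨VR, VB, R, B, h, hR', hB', fun _ => (h.beltDist_le_two hd hsmall R B).antisymm
        (h.two_le_beltDist hd hR' hB'), fun h => by omega⟩
    · obtain ⟨VR, VB, h, hlt⟩ := exists_isSymmetricPi_of_large (d := d) (by omega)
      obtain ⟨R, B, hR, hB⟩ := h.exists_pairs hd
      have hR' := (hR R).2 rfl
      have hB' := (hB B).2 rfl
      refine ⟨VR, VB, R, B, h, hR', hB', fun h => absurd h hsmall, fun _ =>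
        (h.beltDist_le_three R B).antisymm ?_⟩
      have := Order.add_one_le_of_lt (hlt R B hR' hB')
      rwa [two_add_one_eq_three] at this
  refine ⟨fun m VR VB h => ?_, hsharp, fun hs => ?_, fun hl => ?_⟩
  · obtain ⟨R, B, hR, hB⟩ := h.exists_pairs hd
    exact ⟨R, B, hR, hB, fun hs => h.beltDist_le_two hd hs R B, fun _ => h.beltDist_le_three R B⟩
  -- The upper bounds hold for all facet pairs, not only the coloured ones, so they bound the
  -- diameter; the coloured pair of the sharp example bounds it from below.
  · obtain ⟨VR, VB, R, B, h, -, -, h2, -⟩ := hsharp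
    apply le_antisymm
    · refine sSup_le ?_
      rintro _ ⟨m, VR, VB, h, rfl⟩
      exact SimpleGraph.ediam_le_of_edist_le fun P Q => h.beltDist_le_two hd hs P Q
    · rw [← h2 hs]
      exact SimpleGraph.edist_le_ediam.trans (le_sSup ⟨d, VR, VB, h, rfl⟩)
  · obtain ⟨VR, VB, R, B, h, -, -, -, h3⟩ := hsharp
    apply le_antisymm
    · refine sSup_le ?_
      rintro _ ⟨m, VR, VB, h, rfl⟩
      exact SimpleGraph.ediam_le_of_edist_le fun P Q => h.beltDist_le_three P Q
    · rw [← h3 hl]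
      exact SimpleGraph.edist_le_ediam.trans (le_sSup ⟨d, VR, VB, h, rfl⟩)
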